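/- **Setting.** Let $p\ge 0$ and index the coordinates of $\mathbb R^{p+1}$ by $0,1,\dots,p$ ($0$ is the intercept). Let $-\infty\le\mu_1<\mu_2\le\infty$, let $g:(\mu_1,\mu_2)\to\mathbb R$ be continuous and strictly increasing with limits $-\infty$ at $\mu_1$ and $+\infty$ at $\mu_2$, let $\phi>0$ be known, and for each $\mu\in(\mu_1,\mu_2)$ let $F(\cdot,\mu,\phi)$ be a distribution function on $\mathbb R$; $\mathbb E_\mu$ is expectation for $y\sim F(\cdot,\mu,\phi)$. Let $t:\mathbb R\to\mathbb R$ be measurable and $a(\phi)>0$. Let $\rho:\mathbb R\to\mathbb R$ be a bounded $\rho$-function: $\rho$ is continuous, nonnegative and even, $\rho(0)=0$, $\lim_{u\to\infty}\rho(u)=1$, and for $0\le u<v$ one has $\rho(u)\le\rho(v)$, with strict inequality if $\rho(u)<1$. Put $m(\mu)=\arg\min_\gamma \mathbb E_\mu\,\rho\big((t(y)-\gamma)/\sqrt{a(\phi)}\big)$. Let $(y,\mathbf x),(y_1,\mathbf x_1),(y_2,\mathbf x_2),\dots$ be i.i.d. with $\mathbf x=(1,x_1,\dots,x_p)^\top$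 and $y\mid\mathbf x\sim F(\cdot,g^{-1}(\mathbf x^\top\boldsymbol\beta_*),\phi)$, where $\boldsymbol\beta_*\in\mathbb R^{p+1}$. Write $\ell(y,\mathbf x,\boldsymbol\beta)=\rho\big((t(y)-m(g^{-1}(\mathbf x^\top\boldsymbol\beta)))/\sqrt{a(\phi)}\big)$, let $\boldsymbol\Psi$ and $\mathbf J$ be its gradient and Hessian in $\boldsymbol\beta$, and let $\mathbf A=\mathbb E\,\mathbf J(y,\mathbf x,\boldsymbol\beta_*)$ and $\mathbf B=\mathbb E\,\boldsymbol\Psi(y,\mathbf x,\boldsymbol\beta_*)\boldsymbol\Psi(y,\mathbf x,\boldsymbol\beta_*)^\top$. Let $T\subseteq\{0,\dots,p\}$ be the set of penalized coordinates, $T=\{1,\dots,p\}$ (intercept not penalized) or $T=\{0,\dots,p\}$. Let $\boldsymbol\beta_T$ be the vector obtained from $\boldsymbol\beta$ by replacing the coordinates outside $T$ by $0$. The penalty $P_\lambda(\boldsymbol\beta;\alpha)$, with $\alpha$ fixed, is one of * elastic net, $0\le\alpha\le1$: $\lambda\sum_{\ell\in T}\big(\tfrac{1-\alpha}2\beta_\ell^2+\alpha|\beta_\ell|\big)$;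 * bridge, $\alpha\ge1$: $\lambda\sum_{\ell\in T}|\beta_\ell|^\alpha$; * sign: $\lambda\,\|\boldsymbol\beta_T\|_1/\|\boldsymbol\beta_T\|_2$ if $\boldsymbol\beta_T\ne\mathbf 0$, and $0$ otherwise. Let $\lambda_n$ be real, possibly random, penalty parameters, and let the random vector $\hat{\boldsymbol\beta}_n$ be almost surely a global minimizer of $\frac1n\sum_{i=1}^n\ell(y_i,\mathbf x_i,\boldsymbol\beta)+P_{\lambda_n}(\boldsymbol\beta;\alpha)$. **Assumptions.** * (A2) For all $\mu\in(\mu_1,\mu_2)$ the minimizer $m(\mu)$ exists and is unique, and $m$ is strictly increasing. * (C1) For every $y$, $\mu\mapsto F(y,\mu,\phi)$ has three continuous and bounded derivatives on $(\mu_1,\mu_2)$, and $g$ is twice continuously differentiable. * (C2) $\rho$ has three continuous and bounded derivatives; $\psi=\rho'$. * (C3) $\mathbb E_\mu\,\psi'\big((t(y)-m(\mu))/\sqrt{a(\phi)}\big)\neq0$ for all $\mu\in(\mu_1,\mu_2)$. * (C4) There is $\eta>0$ such that, almost surely, $\boldsymbol\Psi(y,\mathbf x,\boldsymbol\beta)$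 and $\mathbf J(y,\mathbf x,\boldsymbol\beta)$ exist whenever $\|\boldsymbol\beta-\boldsymbol\beta_*\|_2\le\eta$, and $\mathbb E\sup_{\|\boldsymbol\beta-\boldsymbol\beta_*\|_2\le\eta}|J^{j,k}(y,\mathbf x,\boldsymbol\beta)|<\infty$ for all $0\le j,k\le p$; moreover $\mathbf A$ is nonsingular. * (P1) There are $\epsilon>0$ and $K$ such that $|P_\lambda(\boldsymbol\beta_1;\alpha)-P_\lambda(\boldsymbol\beta_2;\alpha)|\le K\lambda\|\boldsymbol\beta_1-\boldsymbol\beta_2\|_1$ for all $\lambda\ge0$ and all $\boldsymbol\beta_1,\boldsymbol\beta_2$ in the Euclidean ball $B(\boldsymbol\beta_*,\epsilon)$. **Theorem.** Assume A2, C1–C4 and P1, $\boldsymbol\beta_*\ne\mathbf 0$, $\sqrt n(\hat{\boldsymbol\beta}_n-\boldsymbol\beta_*)=O_{\mathbb P}(1)$ and $\sqrt n\lambda_n\xrightarrow{p}b$ with $0\le b<\infty$. Then $\mathbf B$ is well defined (its entries are expectations of integrable variables), for every $\mathbf w_0\in\mathbb R^{p+1}$ the function $$R(\mathbf w)=\mathbf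 w^\top\mathbf w_0+\tfrac12\mathbf w^\top\mathbf A\mathbf w+b\,\mathbf w^\top\mathbf q(\mathbf w)$$ has a unique minimizer on $\mathbb R^{p+1}$, which depends measurably on $\mathbf w_0$, and $$\sqrt n(\hat{\boldsymbol\beta}_n-\boldsymbol\beta_*)\xrightarrow{d}\arg\min_{\mathbf w}R(\mathbf w),\qquad \mathbf w_0\sim N_{p+1}(\mathbf 0,\mathbf B).$$ Here, with $\operatorname{sign}(0)=0$, $q_\ell(\mathbf w)=0$ for $\ell\notin T$, and for $\ell\in T$: * (i) elastic net: $q_\ell(\mathbf w)=(1-\alpha)\beta_{*,\ell}+\alpha\{\operatorname{sign}(\beta_{*,\ell})\mathbb I_{\{\beta_{*,\ell}\ne0\}}+\operatorname{sign}(w_\ell)\mathbb I_{\{\beta_{*,\ell}=0\}}\}$; * (ii) bridge, $\alpha>1$: $q_\ell(\mathbf w)=\alpha\operatorname{sign}(\beta_{*,\ell})|\beta_{*,\ell}|^{\alpha-1}$; for $\alpha=1$ (lasso) $q_\ell$ is as in (i) with $\alpha=1$; * (iii) sign: $\mathbf q(\mathbf w)=\sum_{\ell\in T}\Big(\nabla_\ell(\boldsymbol\beta_*)\,\mathbb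 I_{\{\beta_{*,\ell}\ne0\}}+\frac{\operatorname{sign}(w_\ell)}{\|\boldsymbol\beta_{*T}\|_2}\mathbb I_{\{\beta_{*,\ell}=0\}}\,\mathbf e_\ell\Big)$, where $\nabla_\ell(\boldsymbol\beta)=-\frac{|\beta_\ell|}{\|\boldsymbol\beta_T\|_2^3}\boldsymbol\beta_T+\frac{\operatorname{sign}(\beta_\ell)}{\|\boldsymbol\beta_T\|_2}\mathbf e_\ell$. -/

import Mathlib

open MeasureTheory ProbabilityTheory Filter Topology Set
open scoped ENNReal Matrix

namespace PenalizedMT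

/-- Parameter vectors `(β₀, β₁, …, βₚ)`, with the Euclidean norm; coordinate `0` is the intercept.
Covariate vectors `(1, x₁, …, xₚ)` live in the same space. -/
abbrev Vec (p : ℕ) : Type := EuclideanSpace ℝ (Fin (p + 1))

/-- Bounded rho-functions, normalized so that the limit at infinity is `1`. -/
structure IsRhoFunction (ρ : ℝ → ℝ) : Prop where
  nonneg : ∀ u, 0 ≤ ρ u
  zero : ρ 0 = 0
  even : ∀ u, ρ u = ρ (-u)
  tendsto_one : Tendsto ρ atTop (𝓝 1)
  mono : ∀ u v, 0 ≤ u → u < v → ρ u ≤ ρ v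
  strict : ∀ u v, 0 ≤ u → u < v → ρ u < 1 → ρ u < ρ v
  continuous : Continuous ρ

/-- The ingredients of a generalized linear model and of the MT loss: the mean range `(μ₁, μ₂)`,
the link `g`, the response distributions `F μ φ` with known scale parameter `φ`, the transformation
`t`, the function `a` (so that `a φ` is the approximate variance of `t y`), and the
rho-function `ρ`. -/
structure Model where
  μ₁ : EReal
  μ₂ : EReal
  g : ℝ → ℝ
  F : ℝ → ℝ → ProbabilityMeasure ℝ
  φ : ℝ
  t : ℝ → ℝ
  a : ℝ → ℝ
  ρ : ℝ → ℝ

namespace Model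

/-- The open interval `(μ₁, μ₂)`, as a set of reals. -/
def range (M : Model) : Set ℝ := {μ | M.μ₁ < (μ : EReal) ∧ (μ : EReal) < M.μ₂}

/-- The standing conventions about a model. The link is a continuous strictly increasing
function on `(μ₁, μ₂)` that tends to `-∞` at `μ₁` and to `+∞` at `μ₂`. -/
structure Standing (M : Model) : Prop where
  lt : M.μ₁ < M.μ₂
  g_continuous : ContinuousOn M.g M.range
  g_strictMono : StrictMonoOn M.g M.range
  g_atBot : Tendsto M.g (comap ((↑) : ℝ → EReal) (𝓝[>] M.μ₁)) atBot
  g_atTop : Tendsto M.g (comap ((↑) : ℝ → EReal) (𝓝[<] M.μ₂)) atTop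
  φ_pos : 0 < M.φ
  a_pos : 0 < M.a M.φ
  t_measurable : Measurable M.t
  isRhoFunction : IsRhoFunction M.ρ

/-- The response distribution with mean parameter `μ`. -/
def resp (M : Model) (μ : ℝ) : Measure ℝ := (M.F μ M.φ : Measure ℝ)

/-- The inverse link `g⁻¹ : ℝ → (μ₁, μ₂)`. -/
noncomputable def linkInv (M : Model) (η : ℝ) : ℝ := Function.invFunOn M.g M.range η

/-- `E_μ (ρ ((t y - γ) / √(a φ)))`. -/
noncomputable def locLoss (M : Model) (μ γ : ℝ) : ℝ :=
  ∫ y, M.ρ ((M.t y - γ) / √(M.a M.φ)) ∂(M.resp μ)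

/-- `γ` is a minimizer of `E_μ (ρ ((t y - ·) / √(a φ)))`. -/
def IsLocMin (M : Model) (μ γ : ℝ) : Prop := ∀ γ', M.locLoss μ γ ≤ M.locLoss μ γ'

/-- `m μ = argmin_γ E_μ (ρ ((t y - γ) / √(a φ)))`. -/
noncomputable def m (M : Model) (μ : ℝ) : ℝ := Classical.epsilon (M.IsLocMin μ)

/-- The MT loss `ρ ((t y - m (g⁻¹ (xᵀ β))) / √(a φ))` of the observation `z = (y, x)`. -/
noncomputable def loss {p : ℕ} (M : Model) (z : ℝ × Vec p) (β : Vec p) : ℝ :=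
  M.ρ ((M.t z.1 - M.m (M.linkInv (inner ℝ z.2 β))) / √(M.a M.φ))

/-- The gradient `Ψ` of the loss in `β`. -/
noncomputable def Psi {p : ℕ} (M : Model) (z : ℝ × Vec p) (β : Vec p) : Vec p :=
  gradient (M.loss z) β

/-- The Hessian matrix `J` of the loss in `β`. -/
noncomputable def J {p : ℕ} (M : Model) (z : ℝ × Vec p) (β : Vec p) :
    Matrix (Fin (p + 1)) (Fin (p + 1)) ℝ :=
  Matrix.of fun j k => (fderiv ℝ (M.Psi z) β (EuclideanSpace.single k 1)) j

/-- `A = E (J (y, x, β_*))`, where `(y, x)` has law `Q`. -/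
noncomputable def A {p : ℕ} (M : Model) (Q : Measure (ℝ × Vec p)) (βs : Vec p) :
    Matrix (Fin (p + 1)) (Fin (p + 1)) ℝ :=
  Matrix.of fun j k => ∫ z, M.J z βs j k ∂Q

/-- `B = E (Ψ (y, x, β_*) Ψ (y, x, β_*)ᵀ)`, where `(y, x)` has law `Q`. -/
noncomputable def B {p : ℕ} (M : Model) (Q : Measure (ℝ × Vec p)) (βs : Vec p) :
    Matrix (Fin (p + 1)) (Fin (p + 1)) ℝ :=
  Matrix.of fun j k => ∫ z, M.Psi z βs j * M.Psi z βs k ∂Q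

/-- `(y, x) ∼ Q` follows the generalized linear model with parameter `βs`: `x = (1, x₁, …, xₚ)`
and `y | x ∼ F (g⁻¹ (xᵀ βs), φ)`. -/
structure IsGLM {p : ℕ} (M : Model) (βs : Vec p) (Q : Measure (ℝ × Vec p))
    [IsFiniteMeasure Q] : Prop where
  intercept : ∀ᵐ z ∂Q, z.2 0 = 1
  cond : ∀ᵐ z ∂Q, condDistrib Prod.fst Prod.snd Q z.2 = M.resp (M.linkInv (inner ℝ z.2 βs))

/-- `m` is uniquely defined and strictly increasing on `(μ₁, μ₂)`. -/
structure A2 (M : Model) : Prop where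
  existsUnique : ∀ μ ∈ M.range, ∃! γ, M.IsLocMin μ γ
  strictMono : StrictMonoOn M.m M.range

/-- The distribution function `F(y, μ, φ)` is three times continuously differentiable in `μ`, with
bounded derivatives, and the link is twice continuously differentiable. -/
structure C1 (M : Model) : Prop where
  contDiff_F : ∀ y, ContDiffOn ℝ 3 (fun μ => cdf (M.resp μ) y) M.range
  bounded_F : ∀ y, ∃ C, ∀ k ∈ Finset.Icc 1 3, ∀ μ ∈ M.range,
    |iteratedDerivWithin k (fun μ => cdf (M.resp μ) y) M.range μ| ≤ C
  contDiff_g : ContDiffOn ℝ 2 M.g M.range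

/-- `ρ` has three continuous and bounded derivatives. -/
structure C2 (M : Model) : Prop where
  contDiff : ContDiff ℝ 3 M.ρ
  bounded : ∃ C, ∀ k ∈ Finset.Icc 1 3, ∀ u, |iteratedDeriv k M.ρ u| ≤ C

/-- `E_μ (ψ' ((t y - m μ) / √(a φ))) ≠ 0`, where `ψ = ρ'`. -/
def C3 (M : Model) : Prop :=
  ∀ μ ∈ M.range, ∫ y, deriv (deriv M.ρ) ((M.t y - M.m μ) / √(M.a M.φ)) ∂(M.resp μ) ≠ 0

/-- For some `η > 0` the gradient and the Hessian of the loss exist on the closed ball of radius `η`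
around `βs`, the supremum over this ball of each entry of the Hessian has a finite expectation, and
`A` is nonsingular. -/
def C4 {p : ℕ} (M : Model) (Q : Measure (ℝ × Vec p)) (βs : Vec p) : Prop :=
  (∃ η > 0,
    (∀ᵐ z ∂Q, ∀ β ∈ Metric.closedBall βs η,
      DifferentiableAt ℝ (M.loss z) β ∧ DifferentiableAt ℝ (M.Psi z) β) ∧
    ∀ j k,
      AEMeasurable (fun z => ⨆ β ∈ Metric.closedBall βs η, ‖M.J z β j k‖ₑ) Q ∧
      ∫⁻ z, ⨆ β ∈ Metric.closedBall βs η, ‖M.J z β j k‖ₑ ∂Q < ∞) ∧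
  (M.A Q βs).det ≠ 0

end Model

/-- The penalty families: elastic net with mixing parameter `α`, bridge with exponent `α`, sign. -/
inductive Penalty where
  | elasticNet (α : ℝ)
  | bridge (α : ℝ)
  | sign

namespace Penalty

/-- Range of the parameter `α`. -/
def Admissible : Penalty → Prop
  | elasticNet α => 0 ≤ α ∧ α ≤ 1
  | bridge α => 1 ≤ α
  | sign => True

/-- Euclidean norm of the subvector of `β` with coordinates in `T`. -/
noncomputable def subNorm {p : ℕ} (T : Finset (Fin (p + 1))) (β : Vec p) : ℝ :=
  √(∑ j ∈ T, β j ^ 2)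

/-- The penalty `P_λ(β; α)`, where `T` is the set of penalized coordinates. For the sign penalty,
division by zero gives the value `0` when the penalized subvector vanishes. -/
noncomputable def eval {p : ℕ} (T : Finset (Fin (p + 1))) : Penalty → ℝ → Vec p → ℝ
  | elasticNet α, lam, β => lam * ∑ j ∈ T, (1 / 2 * (1 - α) * β j ^ 2 + α * |β j|)
  | bridge α, lam, β => lam * ∑ j ∈ T, |β j| ^ α
  | sign, lam, β => lam * ((∑ j ∈ T, |β j|) / subNorm T β)

/-- The vector `q(w)` of the elastic net. -/
noncomputable def elasticNetQ {p : ℕ} (T : Finset (Fin (p + 1))) (α : ℝ) (βs w : Vec p) : Vec p :=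
  ∑ l ∈ T, EuclideanSpace.single l
    ((1 - α) * βs l + α * (if βs l ≠ 0 then Real.sign (βs l) else Real.sign (w l)))

/-- The vector `q` of the bridge penalty with `α > 1`. -/
noncomputable def bridgeQ {p : ℕ} (T : Finset (Fin (p + 1))) (α : ℝ) (βs : Vec p) : Vec p :=
  ∑ l ∈ T, EuclideanSpace.single l (α * (Real.sign (βs l) * |βs l| ^ (α - 1)))

/-- `∇_l(β) = -(|β_l| / ‖β‖³) β + (sign β_l / ‖β‖) e_l`, for the penalized subvector. -/
noncomputable def signGrad {p : ℕ} (T : Finset (Fin (p + 1))) (β : Vec p) (l : Fin (p + 1)) :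
    Vec p :=
  -(|β l| / subNorm T β ^ 3) • (∑ j ∈ T, EuclideanSpace.single j (β j))
    + EuclideanSpace.single l (Real.sign (β l) / subNorm T β)

/-- The vector `q(w)` of the sign penalty. -/
noncomputable def signQ {p : ℕ} (T : Finset (Fin (p + 1))) (βs w : Vec p) : Vec p :=
  ∑ l ∈ T, if βs l ≠ 0 then signGrad T βs l
    else EuclideanSpace.single l (Real.sign (w l) / subNorm T βs)

/-- The vector `q(w)`. The bridge penalty with `α = 1` is the lasso. -/
noncomputable def q {p : ℕ} (T : Finset (Fin (p + 1))) : Penalty → Vec p → Vec p → Vec p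
  | elasticNet α, βs, w => elasticNetQ T α βs w
  | bridge α, βs, w => if α = 1 then elasticNetQ T 1 βs w else bridgeQ T α βs
  | sign, βs, w => signQ T βs w

/-- The penalty is Lipschitz near `βs`, for the `ℓ¹` norm, with a constant proportional to `λ`. -/
def P1 {p : ℕ} (T : Finset (Fin (p + 1))) (pen : Penalty) (βs : Vec p) : Prop :=
  ∃ ε > 0, ∃ K : ℝ, ∀ lam : ℝ, 0 ≤ lam →
    ∀ β₁ ∈ Metric.ball βs ε, ∀ β₂ ∈ Metric.ball βs ε,
      |pen.eval T lam β₁ - pen.eval T lam β₂| ≤ K * lam * ∑ j, |β₁ j - β₂ j|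

end Penalty

/-- The penalized objective function
`(1/n) ∑_{i<n} ρ ((t yᵢ - m (g⁻¹ (xᵢᵀ β))) / √(a φ)) + P_λ(β; α)` of the data
`z i = (yᵢ, xᵢ)`. -/
noncomputable def objective {p : ℕ} (M : Model) (T : Finset (Fin (p + 1))) (pen : Penalty)
    (n : ℕ) (z : ℕ → ℝ × Vec p) (lam : ℝ) (β : Vec p) : ℝ :=
  1 / (n : ℝ) * ∑ i ∈ Finset.range n, M.loss (z i) β + pen.eval T lam β

/-- `X n = O_P(1)`. -/
def BoundedInProb {Ω E : Type*} [MeasurableSpace Ω] [Norm E] (P : Measure Ω) (X : ℕ → Ω → E) :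
    Prop :=
  ∀ ε : ℝ≥0∞, 0 < ε → ∃ C : ℝ, ∀ᶠ n in atTop, P {ω | C < ‖X n ω‖} ≤ ε

/-- The limit process `R(w) = wᵀ w₀ + (1/2) wᵀ A w + b wᵀ q(w)`. -/
noncomputable def R {p : ℕ} (A : Matrix (Fin (p + 1)) (Fin (p + 1)) ℝ) (b : ℝ)
    (q : Vec p → Vec p) (w₀ w : Vec p) : ℝ :=
  inner ℝ w w₀ + 1 / 2 * (w.ofLp ⬝ᵥ A *ᵥ w.ofLp) + b * inner ℝ w (q w)

end PenalizedMT

/-!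
The localized estimator `√n (β̂ₙ - β_*)` minimizes the rescaled increment of the penalized criterion
(`localCriterion`), which is compared with the limit process `R`, evaluated with `w₀` equal to the
score `Gₙ = n^{-1/2} ∑ Ψ(zᵢ, β_*)`. On bounded sets the two are uniformly close in probability
(`abs_localCriterion_sub_le`), and `R` is strongly convex in `w` (`strongConvexOn_R`). Hence the
localized estimator differs from the minimizer `W Gₙ` of `R` by a term that tends to zero in
probability (`tendstoInMeasure_sub_minimizer`). The map `W` is Lipschitz (`norm_minimizer_sub_le`)
and `Gₙ` converges in distribution to `N(0, B)` (`tendstoInDistribution_score`), so the theorem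
follows from the continuous mapping theorem and Slutsky's lemma, without convexity of the loss.

Three points need care.

* The Hessian `J` is not assumed to be continuous. The gradient is differentiable at `β_*`, so each
  loss has a second-order expansion with remainder `o(‖w‖²)`; this remainder is dominated by
  `‖w‖²` times the integrable supremum of the Hessian, so by dominated convergence it is bounded,
  near `β_*`, by `‖w‖²` times a variable of small mean (`RegularLoss.exists_remainder_bound`).
* The gradient is square integrable, so that `B` is well defined, because the loss has values in
  `[0, 1]`: such a function with Hessian at most `S` near a point has there a gradient of squared
  norm at most a constant times `1 + S` (`sq_norm_gradient_le`).
* The true parameter minimizes the expected loss (`Model.Standing.integral_loss_le`), so the gradient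
  is centered and `A` is positive semidefinite; being symmetric and nonsingular it is positive
  definite (`RegularLoss.exists_le_meanHessian`).

For each penalty family, `wᵀ q(w)` is a sum over the penalized coordinates of `a_l w_l + c_l |w_l|`
with `c_l ≥ 0`, hence convex and positively homogeneous, and it is the first-order expansion of the
penalty at `β_*` (`Penalty.isPenaltyTangent`). For the sign penalty this requires a nonzero penalized
subvector of `β_*`, which is forced by the Lipschitz condition on the penalty.
-/

namespace PenalizedMT

/-! ### Second-order Taylor expansion without continuity of the Hessian -/

section Taylor

variable {E : Type*} [NormedAddCommGroup E] [InnerProductSpace ℝ E] [CompleteSpace E]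
  {f : E → ℝ} {x₀ : E} {η S : ℝ}

/-- The remainder of the second-order Taylor expansion of `f` at `x₀`. -/
noncomputable def taylorRem (f : E → ℝ) (x₀ w : E) : ℝ :=
  f (x₀ + w) - f x₀ - inner ℝ (gradient f x₀) w
    - 1 / 2 * inner ℝ (fderiv ℝ (gradient f) x₀ w) w

lemma norm_gradient_sub_le (hη : 0 ≤ η)
    (hd : ∀ x ∈ Metric.closedBall x₀ η, DifferentiableAt ℝ (gradient f) x)
    (hS : ∀ x ∈ Metric.closedBall x₀ η, ‖fderiv ℝ (gradient f) x‖ ≤ S)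
    {x : E} (hx : x ∈ Metric.closedBall x₀ η) :
    ‖gradient f x - gradient f x₀‖ ≤ S * ‖x - x₀‖ :=
  (convex_closedBall x₀ η).norm_image_sub_le_of_norm_fderiv_le hd hS
    (Metric.mem_closedBall_self hη) hx

lemma abs_sub_inner_gradient_le
    (hf : ∀ x ∈ Metric.closedBall x₀ η, DifferentiableAt ℝ f x)
    (hd : ∀ x ∈ Metric.closedBall x₀ η, DifferentiableAt ℝ (gradient f) x)
    (hS : ∀ x ∈ Metric.closedBall x₀ η, ‖fderiv ℝ (gradient f) x‖ ≤ S)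
    {w : E} (hw : ‖w‖ ≤ η) :
    |f (x₀ + w) - f x₀ - inner ℝ (gradient f x₀) w| ≤ S * ‖w‖ ^ 2 := by
  have hη : 0 ≤ η := (norm_nonneg w).trans hw
  have hS0 : 0 ≤ S := (norm_nonneg _).trans (hS x₀ (Metric.mem_closedBall_self hη))
  have hsub : Metric.closedBall x₀ ‖w‖ ⊆ Metric.closedBall x₀ η :=
    Metric.closedBall_subset_closedBall hw
  have key := (convex_closedBall x₀ ‖w‖).norm_image_sub_le_of_norm_hasFDerivWithin_le (𝕜 := ℝ)
    (f := fun y => f y - InnerProductSpace.toDual ℝ E (gradient f x₀) y)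
    (f' := fun y => InnerProductSpace.toDual ℝ E (gradient f y)
      - InnerProductSpace.toDual ℝ E (gradient f x₀)) (C := S * ‖w‖) (x := x₀) (y := x₀ + w)
    (fun y hy => ((hf y (hsub hy)).hasGradientAt.hasFDerivAt.sub
      (ContinuousLinearMap.hasFDerivAt _)).hasFDerivWithinAt)
    (fun y hy => by
      rw [← map_sub, LinearIsometryEquiv.norm_map]
      refine (norm_gradient_sub_le hη hd hS (hsub hy)).trans ?_
      gcongr
      simpa [dist_eq_norm] using hy)
    (Metric.mem_closedBall_self (norm_nonneg w)) (by simp)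
  simp only [InnerProductSpace.toDual_apply_apply, inner_add_right, Real.norm_eq_abs,
    add_sub_cancel_left] at key
  calc _ = |f (x₀ + w) - (inner ℝ (gradient f x₀) x₀ + inner ℝ (gradient f x₀) w)
        - (f x₀ - inner ℝ (gradient f x₀) x₀)| := by congr 1; ring
    _ ≤ _ := key.trans_eq (by ring)

lemma inner_fderiv_gradient_comm (hη : 0 < η)
    (hf : ∀ x ∈ Metric.closedBall x₀ η, DifferentiableAt ℝ f x)
    (hd : DifferentiableAt ℝ (gradient f) x₀) (v w : E) :
    inner ℝ (fderiv ℝ (gradient f) x₀ v) w = inner ℝ (fderiv ℝ (gradient f) x₀ w) v := by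
  let T : E →L[ℝ] (E →L[ℝ] ℝ) := isBoundedBilinearMap_inner.toContinuousLinearMap
  have h1 : HasFDerivAt (fun y => T (gradient f y)) (T ∘L fderiv ℝ (gradient f) x₀) x₀ :=
    T.hasFDerivAt.comp x₀ hd.hasFDerivAt
  have h2 : ∀ᶠ y in 𝓝 x₀, HasFDerivAt f (T (gradient f y)) y := by
    filter_upwards [Metric.closedBall_mem_nhds x₀ hη] with y hy
    exact (hf y hy).hasGradientAt.hasFDerivAt
  exact second_derivative_symmetric_of_eventually h2 h1 v w

/-- Peano form of the remainder: it needs only that the gradient exists near `x₀` and is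
differentiable at `x₀`. -/
lemma taylorRem_isLittleO (hη : 0 < η)
    (hf : ∀ x ∈ Metric.closedBall x₀ η, DifferentiableAt ℝ f x)
    (hd : DifferentiableAt ℝ (gradient f) x₀) {ε : ℝ} (hε : 0 < ε) :
    ∃ δ > 0, ∀ w, ‖w‖ < δ → |taylorRem f x₀ w| ≤ ε * ‖w‖ ^ 2 := by
  have hlo := hd.hasFDerivAt.isLittleO.def hε
  obtain ⟨δ, hδ, hball⟩ := Metric.eventually_nhds_iff_ball.1 hlo
  set L := fderiv ℝ (gradient f) x₀ with hL
  have hsymm := inner_fderiv_gradient_comm hη hf hd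
  refine ⟨min δ η, lt_min hδ hη, fun w hw => ?_⟩
  have hsubη : Metric.closedBall x₀ ‖w‖ ⊆ Metric.closedBall x₀ η :=
    Metric.closedBall_subset_closedBall (hw.le.trans (min_le_right _ _))
  have hsubδ : Metric.closedBall x₀ ‖w‖ ⊆ Metric.ball x₀ δ :=
    Metric.closedBall_subset_ball (hw.trans_le (min_le_left _ _))
  have hquad (y : E) : HasFDerivAt (fun y => 1 / 2 * inner ℝ (L (y - x₀)) (y - x₀))
      (InnerProductSpace.toDual ℝ E (L (y - x₀))) y := by
    have h0 : HasFDerivAt (fun y : E => y - x₀) (ContinuousLinearMap.id ℝ E) y :=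
      (hasFDerivAt_id y).sub_const x₀
    have h1 := ((L.hasFDerivAt.comp y h0).inner ℝ h0).const_mul (1 / 2 : ℝ)
    refine h1.congr_fderiv ?_
    ext v
    simp only [one_div, ContinuousLinearMap.comp_id, FunLike.coe_smul,
      ContinuousLinearMap.coe_comp, Pi.smul_apply, Function.comp_apply,
      ContinuousLinearMap.prod_apply, fderivInnerCLM_apply, ContinuousLinearMap.coe_id', id_eq,
      smul_eq_mul, InnerProductSpace.toDual_apply_apply]
    rw [hsymm v (y - x₀)]
    ring
  have key := (convex_closedBall x₀ ‖w‖).norm_image_sub_le_of_norm_hasFDerivWithin_le (𝕜 := ℝ)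
    (f := fun y => f y - InnerProductSpace.toDual ℝ E (gradient f x₀) y
      - 1 / 2 * inner ℝ (L (y - x₀)) (y - x₀))
    (f' := fun y => InnerProductSpace.toDual ℝ E (gradient f y)
      - InnerProductSpace.toDual ℝ E (gradient f x₀)
      - InnerProductSpace.toDual ℝ E (L (y - x₀))) (C := ε * ‖w‖) (x := x₀) (y := x₀ + w)
    (fun y hy => (((hf y (hsubη hy)).hasGradientAt.hasFDerivAt.sub
      (ContinuousLinearMap.hasFDerivAt _)).sub (hquad y)).hasFDerivWithinAt)
    (fun y hy => by
      rw [← map_sub, ← map_sub, LinearIsometryEquiv.norm_map]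
      refine (hball y (hsubδ hy)).trans ?_
      gcongr
      simpa [dist_eq_norm] using hy)
    (Metric.mem_closedBall_self (norm_nonneg w)) (by simp)
  simp only [InnerProductSpace.toDual_apply_apply, inner_add_right, Real.norm_eq_abs,
    add_sub_cancel_left, sub_self, inner_zero_right, mul_zero, sub_zero] at key
  calc |taylorRem f x₀ w| = |f (x₀ + w)
        - (inner ℝ (gradient f x₀) x₀ + inner ℝ (gradient f x₀) w)
        - 1 / 2 * inner ℝ (L w) w - (f x₀ - inner ℝ (gradient f x₀) x₀)| := by
          congr 1; rw [taylorRem]; ring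
    _ ≤ _ := key.trans_eq (by ring)

/-- A function with values in `[0, 1]` whose Hessian is bounded by `S` on a ball has a gradient of
order at most `√S` at the center. This is what makes the gradient square integrable. -/
lemma sq_norm_gradient_le (hη : 0 < η)
    (hf : ∀ x ∈ Metric.closedBall x₀ η, DifferentiableAt ℝ f x)
    (hd : ∀ x ∈ Metric.closedBall x₀ η, DifferentiableAt ℝ (gradient f) x)
    (hS : ∀ x ∈ Metric.closedBall x₀ η, ‖fderiv ℝ (gradient f) x‖ ≤ S)
    (h0 : ∀ x, 0 ≤ f x) (h1 : ∀ x, f x ≤ 1) :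
    ‖gradient f x₀‖ ^ 2 ≤ 4 * (1 + S) / (min η 1) ^ 2 := by
  have hS0 : 0 ≤ S := (norm_nonneg _).trans (hS x₀ (Metric.mem_closedBall_self hη.le))
  set G := gradient f x₀ with hG
  have hm : 0 < min η 1 := lt_min hη one_pos
  rcases eq_or_ne G 0 with h | h
  · rw [h]; simp; positivity
  have hGn : 0 < ‖G‖ := norm_pos_iff.2 h
  have hs1 : 1 ≤ √(1 + S) := Real.one_le_sqrt.2 (by linarith)
  -- the step that balances the linear gain `s ‖G‖` against the quadratic loss `S s²`
  set s := min η 1 / √(1 + S) with hs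
  have hspos : 0 < s := by positivity
  have hsη : s ≤ η := (div_le_self hm.le hs1).trans (min_le_left _ _)
  have hsS : S * s ^ 2 ≤ 1 := by
    rw [hs, div_pow, Real.sq_sqrt (by linarith)]
    have : (min η 1) ^ 2 ≤ 1 := pow_le_one₀ hm.le (min_le_right _ _)
    rw [mul_div_assoc', div_le_one (by linarith)]
    nlinarith
  have hwn : ‖-(s / ‖G‖) • G‖ = s := by
    rw [norm_smul, norm_neg, Real.norm_of_nonneg (by positivity)]; field_simp
  have key := abs_sub_inner_gradient_le hf hd hS (w := -(s / ‖G‖) • G) (hwn.trans_le hsη)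
  rw [hwn, inner_smul_right, real_inner_self_eq_norm_sq, ← hG] at key
  have hlin : -(s / ‖G‖) * ‖G‖ ^ 2 = -(s * ‖G‖) := by field_simp
  rw [hlin] at key
  have hle : s * ‖G‖ ≤ 2 := by
    have := (abs_le.1 key).2
    linarith [h0 (x₀ + -(s / ‖G‖) • G), h1 x₀]
  have hle2 : ‖G‖ ≤ 2 / s := by rw [le_div_iff₀ hspos]; linarith
  calc ‖G‖ ^ 2 ≤ (2 / s) ^ 2 := by gcongr
    _ = _ := by
      rw [hs, div_pow, div_pow, Real.sq_sqrt (by linarith)]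
      field_simp; norm_num

end Taylor

/-! ### Random losses with an integrable bound on the Hessian -/

section RegularLoss

variable {p : ℕ}

/-- The matrix of a linear operator in the standard basis, with the indexing of `Model.J`. -/
noncomputable def opMatrix (L : Vec p →L[ℝ] Vec p) : Matrix (Fin (p + 1)) (Fin (p + 1)) ℝ :=
  Matrix.of fun j k => L (EuclideanSpace.single k 1) j

lemma dotProduct_mulVec_eq_sum (A : Matrix (Fin (p + 1)) (Fin (p + 1)) ℝ) (w : Vec p) :
    w.ofLp ⬝ᵥ A *ᵥ w.ofLp = ∑ j, ∑ k, A j k * (w j * w k) := by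
  simp only [dotProduct, Matrix.mulVec, Finset.mul_sum]
  exact Finset.sum_congr rfl fun j _ => Finset.sum_congr rfl fun k _ => by ring

lemma eq_sum_single (w : Vec p) : w = ∑ k, w k • EuclideanSpace.single k (1 : ℝ) := by
  ext j
  simp [Finset.sum_apply, Pi.single_apply]

lemma inner_apply_self_eq (L : Vec p →L[ℝ] Vec p) (w : Vec p) :
    inner ℝ (L w) w = w.ofLp ⬝ᵥ opMatrix L *ᵥ w.ofLp := by
  have hL : L w = ∑ k, w k • L (EuclideanSpace.single k 1) := by
    conv_lhs => rw [eq_sum_single w]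
    simp only [map_sum, map_smul]
  rw [dotProduct_mulVec_eq_sum, hL, PiLp.inner_apply]
  refine Finset.sum_congr rfl fun j _ => ?_
  simp only [WithLp.ofLp_sum, WithLp.ofLp_smul, Finset.sum_apply, Pi.smul_apply,
    smul_eq_mul, RCLike.inner_apply, conj_trivial, Finset.mul_sum, opMatrix, Matrix.of_apply]
  exact Finset.sum_congr rfl fun k _ => by ring

lemma abs_opMatrix_le (L : Vec p →L[ℝ] Vec p) (j k : Fin (p + 1)) : |opMatrix L j k| ≤ ‖L‖ := by
  calc |opMatrix L j k| ≤ ‖L (EuclideanSpace.single k 1)‖ :=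
        PiLp.norm_apply_le (L (EuclideanSpace.single k 1)) j
    _ ≤ ‖L‖ * ‖(EuclideanSpace.single k 1 : Vec p)‖ := L.le_opNorm _
    _ = ‖L‖ := by simp

lemma norm_le_sum_abs_opMatrix (L : Vec p →L[ℝ] Vec p) : ‖L‖ ≤ ∑ j, ∑ k, |opMatrix L j k| := by
  refine L.opNorm_le_bound (by positivity) fun w => ?_
  have hL : L w = ∑ k, w k • ∑ j, opMatrix L j k • EuclideanSpace.single j (1 : ℝ) := by
    conv_lhs => rw [eq_sum_single w]
    simp only [map_sum, map_smul]
    exact Finset.sum_congr rfl fun k _ => congrArg _ (eq_sum_single _)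
  rw [hL]
  calc _ ≤ ∑ k, ∑ j, |opMatrix L j k| * ‖w‖ := by
        refine (norm_sum_le _ _).trans (Finset.sum_le_sum fun k _ => ?_)
        rw [norm_smul, mul_comm, ← Finset.sum_mul]
        refine mul_le_mul ?_ (PiLp.norm_apply_le w k) (norm_nonneg _) (by positivity)
        refine (norm_sum_le _ _).trans_eq (Finset.sum_congr rfl fun j _ => ?_)
        simp [norm_smul]
    _ = _ := by
        rw [Finset.sum_comm, Finset.sum_mul]
        exact Finset.sum_congr rfl fun j _ => by rw [Finset.sum_mul]

lemma aemeasurable_vec {Z : Type*} [MeasurableSpace Z] {Q : Measure Z} {f : Z → Vec p}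
    (h : ∀ j, AEMeasurable (fun z => f z j) Q) : AEMeasurable f Q :=
  (WithLp.measurable_toLp 2 _).comp_aemeasurable (aemeasurable_pi_iff.2 h)

/-- A random loss `ℓ z` with values in `[0, 1]` which is twice differentiable on a ball around `x₀`,
where its Hessian is bounded by an integrable variable `S`. -/
structure RegularLoss {Z : Type*} [MeasurableSpace Z] (Q : Measure Z) (ℓ : Z → Vec p → ℝ)
    (x₀ : Vec p) (η : ℝ) (S : Z → ℝ) : Prop where
  pos : 0 < η
  measurable : ∀ β, Measurable fun z => ℓ z β
  nonneg : ∀ z β, 0 ≤ ℓ z β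
  le_one : ∀ z β, ℓ z β ≤ 1
  integrable_bound : Integrable S Q
  differentiableAt : ∀ᵐ z ∂Q, ∀ β ∈ Metric.closedBall x₀ η, DifferentiableAt ℝ (ℓ z) β
  differentiableAt_gradient : ∀ᵐ z ∂Q, ∀ β ∈ Metric.closedBall x₀ η,
    DifferentiableAt ℝ (gradient (ℓ z)) β
  norm_hessian_le : ∀ᵐ z ∂Q, ∀ β ∈ Metric.closedBall x₀ η, ‖fderiv ℝ (gradient (ℓ z)) β‖ ≤ S z

namespace RegularLoss

variable {Z : Type*} [MeasurableSpace Z] {Q : Measure Z} {ℓ : Z → Vec p → ℝ} {x₀ : Vec p} {η : ℝ}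
  {S : Z → ℝ}

/-- The expected Hessian matrix at `x₀`. -/
noncomputable def meanHessian (Q : Measure Z) (ℓ : Z → Vec p → ℝ) (x₀ : Vec p) :
    Matrix (Fin (p + 1)) (Fin (p + 1)) ℝ :=
  Matrix.of fun j k => ∫ z, opMatrix (fderiv ℝ (gradient (ℓ z)) x₀) j k ∂Q

/-- The second-moment matrix of the gradient at `x₀`. -/
noncomputable def gradientCov (Q : Measure Z) (ℓ : Z → Vec p → ℝ) (x₀ : Vec p) :
    Matrix (Fin (p + 1)) (Fin (p + 1)) ℝ :=
  Matrix.of fun j k => ∫ z, gradient (ℓ z) x₀ j * gradient (ℓ z) x₀ k ∂Q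

lemma gradient_apply {f : Vec p → ℝ} {β : Vec p} (hf : DifferentiableAt ℝ f β) (j : Fin (p + 1)) :
    gradient f β j = fderiv ℝ f β (EuclideanSpace.single j 1) := by
  rw [hf.hasGradientAt.hasFDerivAt.fderiv, InnerProductSpace.toDual_apply_apply,
    EuclideanSpace.inner_single_right]
  simp

lemma aemeasurable_gradient (h : RegularLoss Q ℓ x₀ η S) {β : Vec p}
    (hβ : β ∈ Metric.closedBall x₀ η) : AEMeasurable (fun z => gradient (ℓ z) β) Q := by
  refine aemeasurable_vec fun j => ?_
  have hc : Tendsto (fun n : ℕ => ‖(n : ℝ)‖) atTop atTop := by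
    simpa using tendsto_natCast_atTop_atTop (R := ℝ)
  refine aemeasurable_of_tendsto_metrizable_ae atTop (f := fun (n : ℕ) z =>
    (n : ℝ) • (ℓ z (β + (n : ℝ)⁻¹ • EuclideanSpace.single j 1) - ℓ z β)) (fun n => ?_) ?_
  · exact (((h.measurable _).sub (h.measurable _)).const_mul _).aemeasurable
  · filter_upwards [h.differentiableAt] with z hz
    rw [gradient_apply (hz β hβ)]
    exact (hz β hβ).hasFDerivAt.lim _ hc

lemma aemeasurable_hessian_apply (h : RegularLoss Q ℓ x₀ η S) (v : Vec p) :
    AEMeasurable (fun z => fderiv ℝ (gradient (ℓ z)) x₀ v) Q := by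
  obtain ⟨N, hN⟩ := exists_nat_gt (‖v‖ / η)
  have hη := h.pos
  have hNpos : (0 : ℝ) < N := lt_of_le_of_lt (by positivity) hN
  have hc : Tendsto (fun n : ℕ => ‖((n + N : ℕ) : ℝ)‖) atTop atTop := by
    simp only [RCLike.norm_natCast]
    exact (tendsto_natCast_atTop_atTop (R := ℝ)).comp (tendsto_add_atTop_nat N)
  -- the shift by `N` keeps all points of the difference quotients in the ball
  refine aemeasurable_of_tendsto_metrizable_ae atTop (f := fun (n : ℕ) z =>
    ((n + N : ℕ) : ℝ) • (gradient (ℓ z) (x₀ + ((n + N : ℕ) : ℝ)⁻¹ • v) - gradient (ℓ z) x₀))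
    (fun n => ?_) ?_
  · have hnN : (N : ℝ) ≤ ((n + N : ℕ) : ℝ) := by push_cast; linarith [n.cast_nonneg (α := ℝ)]
    have hmem : x₀ + ((n + N : ℕ) : ℝ)⁻¹ • v ∈ Metric.closedBall x₀ η := by
      rw [Metric.mem_closedBall, dist_eq_norm, add_sub_cancel_left, norm_smul, norm_inv,
        Real.norm_of_nonneg (Nat.cast_nonneg _), inv_mul_le_iff₀ (hNpos.trans_le hnN)]
      rw [div_lt_iff₀ hη] at hN
      nlinarith
    have hsub : AEMeasurable (fun z => gradient (ℓ z) (x₀ + ((n + N : ℕ) : ℝ)⁻¹ • v)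
        - gradient (ℓ z) x₀) Q :=
      (h.aemeasurable_gradient hmem).sub
        (h.aemeasurable_gradient (Metric.mem_closedBall_self hη.le))
    exact hsub.const_smul ((n + N : ℕ) : ℝ)
  · filter_upwards [h.differentiableAt_gradient] with z hz
    exact (hz x₀ (Metric.mem_closedBall_self hη.le)).hasFDerivAt.lim _ hc

lemma aemeasurable_taylorRem (h : RegularLoss Q ℓ x₀ η S) (w : Vec p) :
    AEMeasurable (fun z => taylorRem (ℓ z) x₀ w) Q := by
  have h1 := h.aemeasurable_gradient (Metric.mem_closedBall_self h.pos.le)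
  have h2 := h.aemeasurable_hessian_apply w
  have h3 := (h.measurable (x₀ + w)).aemeasurable (μ := Q)
  have h4 := (h.measurable x₀).aemeasurable (μ := Q)
  unfold taylorRem
  exact ((h3.sub h4).sub (h1.inner aemeasurable_const)).sub
    ((h2.inner aemeasurable_const).const_mul _)

lemma abs_taylorRem_le (h : RegularLoss Q ℓ x₀ η S) :
    ∀ᵐ z ∂Q, ∀ w, ‖w‖ ≤ η → |taylorRem (ℓ z) x₀ w| ≤ 2 * S z * ‖w‖ ^ 2 := by
  filter_upwards [h.differentiableAt, h.differentiableAt_gradient, h.norm_hessian_le]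
    with z h1 h2 h3 w hw
  have ha := abs_sub_inner_gradient_le h1 h2 h3 hw
  have hL := h3 x₀ (Metric.mem_closedBall_self h.pos.le)
  have hb : |inner ℝ (fderiv ℝ (gradient (ℓ z)) x₀ w) w| ≤ S z * ‖w‖ ^ 2 := by
    refine (abs_real_inner_le_norm _ _).trans ?_
    calc _ ≤ (‖fderiv ℝ (gradient (ℓ z)) x₀‖ * ‖w‖) * ‖w‖ := by
          gcongr; exact ContinuousLinearMap.le_opNorm _ _
      _ ≤ (S z * ‖w‖) * ‖w‖ := by gcongr
      _ = _ := by ring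
  rw [taylorRem]
  rw [abs_le] at *
  constructor <;> nlinarith [ha.1, ha.2, hb.1, hb.2]

/-- The supremum over the ball of radius `δ` of `|taylorRem| / ‖w‖²`, taken over a countable dense
set of vectors `w` so as to be measurable. -/
noncomputable def remEnvelope (ℓ : Z → Vec p → ℝ) (x₀ : Vec p) (δ : ℝ) (z : Z) : ℝ≥0∞ :=
  ⨆ i : ℕ, if ‖TopologicalSpace.denseSeq (Vec p) i‖ < δ then
    ENNReal.ofReal (|taylorRem (ℓ z) x₀ (TopologicalSpace.denseSeq (Vec p) i)|
      / ‖TopologicalSpace.denseSeq (Vec p) i‖ ^ 2) else 0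

lemma aemeasurable_remEnvelope (h : RegularLoss Q ℓ x₀ η S) (δ : ℝ) :
    AEMeasurable (remEnvelope ℓ x₀ δ) Q := by
  refine AEMeasurable.iSup fun i => ?_
  split_ifs
  · have := h.aemeasurable_taylorRem (TopologicalSpace.denseSeq (Vec p) i)
    fun_prop
  · exact aemeasurable_const

lemma remEnvelope_le {Y : Type*} {f : Y → Vec p → ℝ} {z : Y} {δ C : ℝ} (hC : 0 ≤ C)
    (hf : ∀ w, ‖w‖ < δ → |taylorRem (f z) x₀ w| ≤ C * ‖w‖ ^ 2) :
    remEnvelope f x₀ δ z ≤ ENNReal.ofReal C := by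
  refine iSup_le fun i => ?_
  split_ifs with hi
  · exact ENNReal.ofReal_le_ofReal (div_le_of_le_mul₀ (by positivity) hC (hf _ hi))
  · exact zero_le

lemma taylorRem_zero (f : Vec p → ℝ) : taylorRem f x₀ 0 = 0 := by simp [taylorRem]

lemma abs_taylorRem_le_remEnvelope {Y : Type*} {ℓ : Y → Vec p → ℝ} {z : Y} {δ : ℝ}
    (hd : ∀ β ∈ Metric.ball x₀ δ, DifferentiableAt ℝ (ℓ z) β) (hfin : remEnvelope ℓ x₀ δ z ≠ ∞)
    {w : Vec p} (hw : ‖w‖ < δ) :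
    |taylorRem (ℓ z) x₀ w| ≤ (remEnvelope ℓ x₀ δ z).toReal * ‖w‖ ^ 2 := by
  have hcl : w ∈ closure (Metric.ball 0 δ ∩ Set.range (TopologicalSpace.denseSeq (Vec p))) :=
    (TopologicalSpace.denseRange_denseSeq (Vec p)).open_subset_closure_inter Metric.isOpen_ball
      (by simpa using hw)
  refine ContinuousWithinAt.closure_le hcl (f := fun w => |taylorRem (ℓ z) x₀ w|) ?_
    (g := fun w => (remEnvelope ℓ x₀ δ z).toReal * ‖w‖ ^ 2) (by fun_prop) ?_
  · have hc : ContinuousAt (fun w => ℓ z (x₀ + w)) w := by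
      refine ContinuousAt.comp (g := ℓ z) ?_ (by fun_prop)
      exact (hd _ (by simpa using hw)).continuousAt
    exact (((hc.sub continuousAt_const).sub (by fun_prop)).sub
      (by fun_prop)).abs.continuousWithinAt
  · rintro _ ⟨hy, i, rfl⟩
    rcases eq_or_ne (TopologicalSpace.denseSeq (Vec p) i) 0 with h0 | h0
    · simp [h0, taylorRem_zero]
    rw [← div_le_iff₀ (by positivity), ← ENNReal.ofReal_le_iff_le_toReal hfin]
    refine le_iSup_of_le i ?_
    rw [if_pos (by simpa using hy)]

/-- Uniform control of the Taylor remainders by an integrable variable of small mean. -/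
lemma exists_remainder_bound (h : RegularLoss Q ℓ x₀ η S) {ε : ℝ} (hε : 0 < ε) :
    ∃ δ > 0, ∃ r : Z → ℝ, Integrable r Q ∧ ∫ z, r z ∂Q < ε ∧
      ∀ᵐ z ∂Q, ∀ w, ‖w‖ < δ → |taylorRem (ℓ z) x₀ w| ≤ r z * ‖w‖ ^ 2 := by
  have hη := h.pos
  set d : ℕ → ℝ := fun k => η / (k + 1) with hd
  have hdpos (k : ℕ) : 0 < d k := by positivity
  have hdη (k : ℕ) : d k ≤ η := div_le_self hη.le (by linarith [k.cast_nonneg (α := ℝ)])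
  have hd0 : Tendsto d atTop (𝓝 0) := tendsto_const_div_atTop_nhds_zero_nat η |>.comp
    (tendsto_add_atTop_nat 1) |>.congr fun k => by simp [hd]
  have hS0 : ∀ᵐ z ∂Q, 0 ≤ S z := by
    filter_upwards [h.norm_hessian_le] with z hz
    exact (norm_nonneg _).trans (hz x₀ (Metric.mem_closedBall_self hη.le))
  have hbd (k : ℕ) : ∀ᵐ z ∂Q, remEnvelope ℓ x₀ (d k) z ≤ ENNReal.ofReal (2 * S z) := by
    filter_upwards [h.abs_taylorRem_le, hS0] with z hz hS
    exact remEnvelope_le (by positivity) fun w hw => hz w (hw.le.trans (hdη k))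
  have hbi : ∫⁻ z, ENNReal.ofReal (2 * S z) ∂Q ≠ ∞ :=
    (h.integrable_bound.const_mul 2).lintegral_lt_top.ne
  have hlim : Tendsto (fun k => ∫⁻ z, remEnvelope ℓ x₀ (d k) z ∂Q) atTop (𝓝 (∫⁻ _, 0 ∂Q)) := by
    refine tendsto_lintegral_of_dominated_convergence' _
      (fun k => h.aemeasurable_remEnvelope (d k)) hbd hbi ?_
    filter_upwards [h.differentiableAt, h.differentiableAt_gradient] with z h1 h2
    refine ENNReal.tendsto_nhds_zero.2 fun e he => ?_
    obtain ⟨c, hc0, hce⟩ := ENNReal.lt_iff_exists_real_btwn.1 he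
    have hc : 0 < c := by simpa using hce.1
    obtain ⟨δ, hδ, hrem⟩ := taylorRem_isLittleO hη h1
      (h2 x₀ (Metric.mem_closedBall_self hη.le)) hc
    filter_upwards [hd0.eventually_lt_const hδ] with k hk
    exact (remEnvelope_le hc.le fun w hw => hrem w (hw.trans hk)).trans hce.2.le
  rw [lintegral_zero] at hlim
  obtain ⟨k, hk⟩ := (hlim.eventually_lt_const (ENNReal.ofReal_pos.2 hε)).exists
  have hfin : ∀ᵐ z ∂Q, remEnvelope ℓ x₀ (d k) z < ∞ := by
    filter_upwards [hbd k] with z hz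
    exact hz.trans_lt ENNReal.ofReal_lt_top
  refine ⟨d k, hdpos k, fun z => (remEnvelope ℓ x₀ (d k) z).toReal,
    integrable_toReal_of_lintegral_ne_top (h.aemeasurable_remEnvelope _) hk.ne_top, ?_, ?_⟩
  · rw [integral_toReal (h.aemeasurable_remEnvelope _) hfin]
    exact (ENNReal.lt_ofReal_iff_toReal_lt hk.ne_top).1 hk
  · filter_upwards [hfin, h.differentiableAt] with z hz hdz w hw
    exact abs_taylorRem_le_remEnvelope (fun β hβ => hdz β
      (Metric.closedBall_subset_closedBall (hdη k) (Metric.ball_subset_closedBall hβ))) hz.ne hw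

lemma integrable_opMatrix_hessian (h : RegularLoss Q ℓ x₀ η S) (j k : Fin (p + 1)) :
    Integrable (fun z => opMatrix (fderiv ℝ (gradient (ℓ z)) x₀) j k) Q := by
  refine h.integrable_bound.mono' ?_ ?_
  · have := (h.aemeasurable_hessian_apply (EuclideanSpace.single k 1))
    exact (AEMeasurable.aestronglyMeasurable
      ((EuclideanSpace.proj (𝕜 := ℝ) j).continuous.measurable.comp_aemeasurable this))
  · filter_upwards [h.norm_hessian_le] with z hz
    exact (abs_opMatrix_le _ j k).trans (hz x₀ (Metric.mem_closedBall_self h.pos.le))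

lemma integrable_inner_hessian (h : RegularLoss Q ℓ x₀ η S) (w : Vec p) :
    Integrable (fun z => inner ℝ (fderiv ℝ (gradient (ℓ z)) x₀ w) w) Q := by
  simp_rw [inner_apply_self_eq, dotProduct_mulVec_eq_sum]
  exact integrable_finsetSum _ fun j _ => integrable_finsetSum _ fun k _ =>
    (h.integrable_opMatrix_hessian j k).mul_const _

lemma integral_inner_hessian (h : RegularLoss Q ℓ x₀ η S) (w : Vec p) :
    ∫ z, inner ℝ (fderiv ℝ (gradient (ℓ z)) x₀ w) w ∂Q
      = w.ofLp ⬝ᵥ meanHessian Q ℓ x₀ *ᵥ w.ofLp := by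
  simp_rw [inner_apply_self_eq, dotProduct_mulVec_eq_sum]
  rw [integral_finsetSum _ fun j _ => integrable_finsetSum _ fun k _ =>
    (h.integrable_opMatrix_hessian j k).mul_const _]
  refine Finset.sum_congr rfl fun j _ => ?_
  rw [integral_finsetSum _ fun k _ => (h.integrable_opMatrix_hessian j k).mul_const _]
  exact Finset.sum_congr rfl fun k _ => integral_mul_const _ _

lemma meanHessian_isHermitian (h : RegularLoss Q ℓ x₀ η S) :
    (meanHessian Q ℓ x₀).IsHermitian := by
  ext j k
  simp only [Matrix.conjTranspose_apply, star_trivial, meanHessian, Matrix.of_apply]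
  refine integral_congr_ae ?_
  filter_upwards [h.differentiableAt, h.differentiableAt_gradient] with z h1 h2
  have := inner_fderiv_gradient_comm h.pos h1 (h2 x₀ (Metric.mem_closedBall_self h.pos.le))
    (EuclideanSpace.single j 1) (EuclideanSpace.single k 1)
  simpa [EuclideanSpace.inner_single_right, opMatrix] using this

variable [IsProbabilityMeasure Q]

lemma memLp_gradient (h : RegularLoss Q ℓ x₀ η S) : MemLp (fun z => gradient (ℓ z) x₀) 2 Q := by
  have hm := h.aemeasurable_gradient (Metric.mem_closedBall_self h.pos.le)
  rw [memLp_two_iff_integrable_sq_norm hm.aestronglyMeasurable]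
  refine (((integrable_const 1).add h.integrable_bound).const_mul
    (4 / (min η 1) ^ 2)).mono' (hm.norm.pow_const 2).aestronglyMeasurable ?_
  filter_upwards [h.differentiableAt, h.differentiableAt_gradient, h.norm_hessian_le]
    with z h1 h2 h3
  rw [Real.norm_of_nonneg (by positivity)]
  refine (sq_norm_gradient_le h.pos h1 h2 h3 (h.nonneg z) (h.le_one z)).trans_eq ?_
  simp only [Pi.add_apply]
  ring

lemma memLp_inner_gradient (h : RegularLoss Q ℓ x₀ η S) (w : Vec p) :
    MemLp (fun z => inner ℝ (gradient (ℓ z) x₀) w) 2 Q :=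
  h.memLp_gradient.inner_const w

lemma memLp_gradient_apply (h : RegularLoss Q ℓ x₀ η S) (j : Fin (p + 1)) :
    MemLp (fun z => gradient (ℓ z) x₀ j) 2 Q := by
  refine (memLp_congr_ae (Eventually.of_forall fun z => ?_)).1
    (h.memLp_inner_gradient (EuclideanSpace.single j (1 : ℝ)))
  rw [EuclideanSpace.inner_single_right, one_mul, conj_trivial]

lemma integrable_gradient_mul (h : RegularLoss Q ℓ x₀ η S) (j k : Fin (p + 1)) :
    Integrable (fun z => gradient (ℓ z) x₀ j * gradient (ℓ z) x₀ k) Q :=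
  (h.memLp_gradient_apply j).integrable_mul (h.memLp_gradient_apply k)

lemma integrable (h : RegularLoss Q ℓ x₀ η S) (β : Vec p) : Integrable (fun z => ℓ z β) Q :=
  Integrable.of_bound (h.measurable β).aestronglyMeasurable 1 (Eventually.of_forall fun z => by
    rw [Real.norm_of_nonneg (h.nonneg z β)]; exact h.le_one z β)

/-- Second-order expansion of the expected loss. -/
lemma abs_integral_sub_le (h : RegularLoss Q ℓ x₀ η S) {ε : ℝ} (hε : 0 < ε) :
    ∃ δ > 0, ∀ w, ‖w‖ < δ → |∫ z, ℓ z (x₀ + w) ∂Q - ∫ z, ℓ z x₀ ∂Q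
      - ∫ z, inner ℝ (gradient (ℓ z) x₀) w ∂Q
      - 1 / 2 * (w.ofLp ⬝ᵥ meanHessian Q ℓ x₀ *ᵥ w.ofLp)| ≤ ε * ‖w‖ ^ 2 := by
  obtain ⟨δ, hδ, r, hr, hrε, hrem⟩ := h.exists_remainder_bound hε
  refine ⟨δ, hδ, fun w hw => ?_⟩
  have h1 := h.integrable (x₀ + w)
  have h2 := h.integrable x₀
  have h3 := (h.memLp_inner_gradient w).integrable one_le_two
  have h4 := (h.integrable_inner_hessian w).const_mul (1 / 2)
  have h5 : Integrable (fun z => ℓ z (x₀ + w) - ℓ z x₀) Q := h1.sub h2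
  have h6 : Integrable (fun z => ℓ z (x₀ + w) - ℓ z x₀ - inner ℝ (gradient (ℓ z) x₀) w) Q :=
    h5.sub h3
  rw [← h.integral_inner_hessian, ← integral_const_mul, ← integral_sub h1 h2,
    ← integral_sub h5 h3, ← integral_sub h6 h4]
  refine abs_integral_le_integral_abs.trans ?_
  calc _ ≤ ∫ z, r z * ‖w‖ ^ 2 ∂Q := by
        refine integral_mono_ae (h6.sub h4).abs (hr.mul_const _) ?_
        filter_upwards [hrem] with z hz
        exact hz w hw
    _ = (∫ z, r z ∂Q) * ‖w‖ ^ 2 := integral_mul_const _ _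
    _ ≤ _ := by gcongr

/-- At a minimizer of the expected loss the gradient is centered. -/
lemma integral_inner_gradient_eq_zero (h : RegularLoss Q ℓ x₀ η S)
    (hmin : ∀ β, ∫ z, ℓ z x₀ ∂Q ≤ ∫ z, ℓ z β ∂Q) (w : Vec p) :
    ∫ z, inner ℝ (gradient (ℓ z) x₀) w ∂Q = 0 := by
  suffices key : ∀ w : Vec p, 0 ≤ ∫ z, inner ℝ (gradient (ℓ z) x₀) w ∂Q by
    refine le_antisymm ?_ (key w)
    have := key (-w)
    simp only [inner_neg_right, integral_neg] at this
    linarith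
  intro w
  obtain ⟨δ, hδ, hexp⟩ := h.abs_integral_sub_le one_pos
  set a := ∫ z, inner ℝ (gradient (ℓ z) x₀) w ∂Q
  set c := w.ofLp ⬝ᵥ meanHessian Q ℓ x₀ *ᵥ w.ofLp with hc
  have hlim : Tendsto (fun s : ℝ => a + s * (1 / 2 * c + ‖w‖ ^ 2)) (𝓝[>] 0) (𝓝 a) := by
    have : Tendsto (fun s : ℝ => a + s * (1 / 2 * c + ‖w‖ ^ 2)) (𝓝 0)
        (𝓝 (a + 0 * (1 / 2 * c + ‖w‖ ^ 2))) := by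
      refine Continuous.tendsto ?_ 0
      fun_prop
    simpa using this.mono_left nhdsWithin_le_nhds
  refine ge_of_tendsto hlim ?_
  have hsmall : ∀ᶠ s : ℝ in 𝓝[>] 0, ‖s • w‖ < δ := by
    have : Tendsto (fun s : ℝ => ‖s • w‖) (𝓝 0) (𝓝 ‖(0 : ℝ) • w‖) := by
      refine Continuous.tendsto ?_ 0
      fun_prop
    rw [zero_smul, norm_zero] at this
    exact (this.mono_left nhdsWithin_le_nhds).eventually_lt_const hδ
  filter_upwards [hsmall, self_mem_nhdsWithin] with s hs (hs0 : 0 < s)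
  have := (abs_le.1 (hexp (s • w) hs)).2
  simp only [inner_smul_right, integral_const_mul, WithLp.ofLp_smul, Matrix.mulVec_smul,
    dotProduct_smul, smul_dotProduct, smul_eq_mul, norm_smul, Real.norm_of_nonneg hs0.le,
    ← hc] at this
  have h2 := hmin (x₀ + s • w)
  have : 0 ≤ s * (a + s * (1 / 2 * c + ‖w‖ ^ 2)) := by nlinarith
  exact nonneg_of_mul_nonneg_right this hs0

lemma meanHessian_nonneg (h : RegularLoss Q ℓ x₀ η S)
    (hmin : ∀ β, ∫ z, ℓ z x₀ ∂Q ≤ ∫ z, ℓ z β ∂Q) (w : Vec p) :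
    0 ≤ w.ofLp ⬝ᵥ meanHessian Q ℓ x₀ *ᵥ w.ofLp := by
  rcases eq_or_ne w 0 with rfl | hw
  · simp
  have hwn : 0 < ‖w‖ := norm_pos_iff.2 hw
  set c := w.ofLp ⬝ᵥ meanHessian Q ℓ x₀ *ᵥ w.ofLp with hc
  by_contra! hneg
  obtain ⟨δ, hδ, hexp⟩ := h.abs_integral_sub_le (ε := -c / (4 * ‖w‖ ^ 2))
    (div_pos (by linarith) (by positivity))
  set s := δ / (2 * ‖w‖) with hs
  have hs0 : 0 < s := by positivity
  have hsw : ‖s • w‖ < δ := by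
    rw [norm_smul, Real.norm_of_nonneg hs0.le, hs]
    field_simp; linarith
  have h1 := (abs_le.1 (hexp (s • w) hsw)).2
  rw [h.integral_inner_gradient_eq_zero hmin] at h1
  simp only [WithLp.ofLp_smul, Matrix.mulVec_smul,
    dotProduct_smul, smul_dotProduct, smul_eq_mul, norm_smul, Real.norm_of_nonneg hs0.le,
    ← hc] at h1
  have h2 := hmin (x₀ + s • w)
  have h3 : -c / (4 * ‖w‖ ^ 2) * (s * ‖w‖) ^ 2 = -c * s ^ 2 / 4 := by field_simp
  rw [h3] at h1
  nlinarith [mul_pos hs0 hs0]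

lemma exists_le_meanHessian (h : RegularLoss Q ℓ x₀ η S)
    (hmin : ∀ β, ∫ z, ℓ z x₀ ∂Q ≤ ∫ z, ℓ z β ∂Q) (hdet : (meanHessian Q ℓ x₀).det ≠ 0) :
    ∃ κ > 0, ∀ w : Vec p, κ * ‖w‖ ^ 2 ≤ w.ofLp ⬝ᵥ meanHessian Q ℓ x₀ *ᵥ w.ofLp := by
  set A := meanHessian Q ℓ x₀ with hA
  have hpsd : A.PosSemidef := .of_dotProduct_mulVec_nonneg h.meanHessian_isHermitian fun x => by
    simpa using h.meanHessian_nonneg hmin (WithLp.toLp 2 x)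
  have hpd : A.PosDef := hpsd.posDef_iff_isUnit.2
    ((Matrix.isUnit_iff_isUnit_det A).2 (isUnit_iff_ne_zero.2 hdet))
  have hcont : Continuous fun w : Vec p => w.ofLp ⬝ᵥ A *ᵥ w.ofLp := by
    simp_rw [dotProduct_mulVec_eq_sum]
    fun_prop
  obtain ⟨u, hu, humin⟩ := (isCompact_sphere (0 : Vec p) 1).exists_isMinOn
    ⟨EuclideanSpace.single 0 1, by simp⟩ hcont.continuousOn
  have hu0 : u.ofLp ≠ 0 := by
    intro h0
    have : u = 0 := by ext j; simp [h0]
    simp [this] at hu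
  refine ⟨_, by simpa using hpd.dotProduct_mulVec_pos hu0, fun w => ?_⟩
  rcases eq_or_ne w 0 with rfl | hw
  · simp
  have hwn : 0 < ‖w‖ := norm_pos_iff.2 hw
  have := humin (a := ‖w‖⁻¹ • w) (by simp [norm_smul, hwn.ne'])
  simp only [mem_ofPred_eq, WithLp.ofLp_smul, Matrix.mulVec_smul, dotProduct_smul, smul_dotProduct,
    smul_eq_mul] at this
  calc _ ≤ ‖w‖⁻¹ * (‖w‖⁻¹ * (w.ofLp ⬝ᵥ A *ᵥ w.ofLp)) * ‖w‖ ^ 2 := by gcongr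
    _ = _ := by field_simp

end RegularLoss

end RegularLoss

/-! ### The limit process and its minimizer -/

section StrongConvexity

variable {E : Type*} [NormedAddCommGroup E] [NormedSpace ℝ E] {Φ : E → ℝ} {κ : ℝ} {W : E}

lemma add_le_of_strongConvexOn (h : StrongConvexOn univ κ Φ) (hW : ∀ w, Φ W ≤ Φ w) (w : E) :
    Φ W + κ / 4 * ‖w - W‖ ^ 2 ≤ Φ w := by
  have h1 := h.2 (mem_univ w) (mem_univ W) (one_half_pos (α := ℝ)).le one_half_pos.le (by norm_num)
  have h2 := hW ((1 / 2 : ℝ) • w + (1 / 2 : ℝ) • W)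
  simp only [smul_eq_mul] at h1
  linarith

/-- A point `h` at distance at least `τ` from the minimizer can be improved, by a fixed amount,
without leaving the ball of radius `τ` around `h`. Hence no a priori bound on the minimizer is
needed to show that it is close to an approximate minimizer on a bounded set. -/
lemma exists_improvement_of_strongConvexOn (h : StrongConvexOn univ κ Φ) (hκ : 0 < κ)
    (hW : ∀ w, Φ W ≤ Φ w) {τ : ℝ} (hτ : 0 < τ) {x : E} (hx : τ ≤ ‖x - W‖) :
    ∃ w, ‖w - x‖ ≤ τ ∧ Φ w + κ / 4 * τ ^ 2 ≤ Φ x := by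
  set d := ‖x - W‖ with hd
  have hd0 : 0 < d := hτ.trans_le hx
  set s := τ / d with hs
  have hs0 : 0 < s := by positivity
  have hs1 : s ≤ 1 := (div_le_one hd0).2 hx
  have hsd : s * d = τ := by rw [hs]; field_simp
  refine ⟨(1 - s) • x + s • W, ?_, ?_⟩
  · have : (1 - s) • x + s • W - x = -(s • (x - W)) := by module
    rw [this, norm_neg, norm_smul, Real.norm_of_nonneg hs0.le, hsd]
  · have h1 := h.2 (mem_univ x) (mem_univ W) (sub_nonneg.2 hs1) hs0.le (by ring)
    have h2 := add_le_of_strongConvexOn h hW x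
    simp only [smul_eq_mul, ← hd] at h1 h2
    have h3 : s * (Φ W + κ / 4 * d ^ 2) ≤ s * Φ x := by gcongr
    have h4 : κ / 4 * τ ^ 2 ≤ s * (κ / 4 * d ^ 2) + (1 - s) * s * (κ / 2 * d ^ 2) := by
      have e : s * (κ / 4 * d ^ 2) + (1 - s) * s * (κ / 2 * d ^ 2)
          = κ / 4 * (τ * d) + (1 - s) * (κ / 2 * (τ * d)) := by rw [← hsd]; ring
      have h5 : κ / 4 * τ ^ 2 ≤ κ / 4 * (τ * d) := by rw [sq]; gcongr
      have h6 : 0 ≤ (1 - s) * (κ / 2 * (τ * d)) :=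
        mul_nonneg (by linarith) (by positivity)
      linarith
    linarith

end StrongConvexity

section LimitProcess

variable {p : ℕ} {A : Matrix (Fin (p + 1)) (Fin (p + 1)) ℝ} {κ b : ℝ} {q : Vec p → Vec p}

lemma quadForm_convexCombination (A : Matrix (Fin (p + 1)) (Fin (p + 1)) ℝ) (x y : Vec p)
    (s t : ℝ) (hst : s + t = 1) :
    (s • x + t • y).ofLp ⬝ᵥ A *ᵥ (s • x + t • y).ofLp
      = s * (x.ofLp ⬝ᵥ A *ᵥ x.ofLp) + t * (y.ofLp ⬝ᵥ A *ᵥ y.ofLp)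
        - s * t * ((x - y).ofLp ⬝ᵥ A *ᵥ (x - y).ofLp) := by
  obtain rfl : s = 1 - t := by linarith
  simp only [WithLp.ofLp_add, WithLp.ofLp_smul, WithLp.ofLp_sub, Matrix.mulVec_add,
    Matrix.mulVec_sub, Matrix.mulVec_smul, dotProduct_add, add_dotProduct, dotProduct_sub,
    sub_dotProduct, smul_dotProduct, dotProduct_smul, smul_eq_mul]
  ring

lemma strongConvexOn_R (hκ : ∀ w : Vec p, κ * ‖w‖ ^ 2 ≤ w.ofLp ⬝ᵥ A *ᵥ w.ofLp) (hb : 0 ≤ b)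
    (hD : ConvexOn ℝ univ fun w => inner ℝ w (q w)) (w₀ : Vec p) :
    StrongConvexOn univ κ (R A b q w₀) := by
  refine ⟨convex_univ, fun x _ y _ s t hs ht hst => ?_⟩
  have h1 := hD.2 (mem_univ x) (mem_univ y) hs ht hst
  have h2 := quadForm_convexCombination A x y s t hst
  have h3 : s * t * (κ * ‖x - y‖ ^ 2) ≤ s * t * ((x - y).ofLp ⬝ᵥ A *ᵥ (x - y).ofLp) := by
    gcongr; exact hκ _
  have h4 := mul_le_mul_of_nonneg_left h1 hb
  have h5 : inner ℝ (s • x + t • y) w₀ = s * inner ℝ x w₀ + t * inner ℝ y w₀ := by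
    simp [inner_add_left, inner_smul_left]
  simp only [R, smul_eq_mul] at *
  rw [h2, h5]
  linarith

lemma exists_minimizer_R (hκ0 : 0 < κ) (hκ : ∀ w : Vec p, κ * ‖w‖ ^ 2 ≤ w.ofLp ⬝ᵥ A *ᵥ w.ofLp)
    (hcont : Continuous fun w => inner ℝ w (q w)) {C : ℝ}
    (hC : ∀ w, |inner ℝ w (q w)| ≤ C * ‖w‖) (w₀ : Vec p) :
    ∃ W, ∀ w, R A b q w₀ W ≤ R A b q w₀ w := by
  refine Continuous.exists_forall_le ?_ ?_
  · unfold R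
    simp_rw [dotProduct_mulVec_eq_sum]
    fun_prop
  · have hlow (w : Vec p) : ‖w‖ * (κ / 2 * ‖w‖ - (‖w₀‖ + |b| * C)) ≤ R A b q w₀ w := by
      have h1 := (abs_le.1 (abs_real_inner_le_norm w w₀)).1
      have h2 : -(|b| * (C * ‖w‖)) ≤ b * inner ℝ w (q w) := by
        refine (abs_le.1 ?_).1
        rw [abs_mul]
        gcongr
        exact hC w
      have h3 := hκ w
      rw [R]
      linarith
    refine tendsto_atTop_mono hlow ?_
    have hn : Tendsto (fun w : Vec p => ‖w‖) (cocompact _) atTop := tendsto_norm_cocompact_atTop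
    refine hn.atTop_mul_atTop₀ ?_
    exact tendsto_atTop_add_const_right _ _ (hn.const_mul_atTop (by positivity))

/-- The minimizer of `R` is a Lipschitz function of `w₀`. -/
lemma norm_minimizer_sub_le (hκ0 : 0 < κ)
    (hκ : ∀ w : Vec p, κ * ‖w‖ ^ 2 ≤ w.ofLp ⬝ᵥ A *ᵥ w.ofLp) (hb : 0 ≤ b)
    (hD : ConvexOn ℝ univ fun w => inner ℝ w (q w)) {W : Vec p → Vec p}
    (hW : ∀ w₀ w, R A b q w₀ (W w₀) ≤ R A b q w₀ w) (u v : Vec p) :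
    ‖W u - W v‖ ≤ 2 / κ * ‖u - v‖ := by
  have h1 := add_le_of_strongConvexOn (strongConvexOn_R hκ hb hD u) (hW u) (W v)
  have h2 := add_le_of_strongConvexOn (strongConvexOn_R hκ hb hD v) (hW v) (W u)
  rw [norm_sub_rev] at h1
  have h3 : κ / 2 * ‖W u - W v‖ ^ 2 ≤ inner ℝ (W u - W v) (v - u) := by
    simp only [R, inner_sub_left, inner_sub_right] at *
    linarith
  have h4 := h3.trans (real_inner_le_norm _ _)
  rw [norm_sub_rev v u] at h4
  rcases eq_or_lt_of_le (norm_nonneg (W u - W v)) with h0 | h0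
  · rw [← h0]; positivity
  · have : κ / 2 * ‖W u - W v‖ ≤ ‖u - v‖ := by
      refine le_of_mul_le_mul_right ?_ h0
      linarith
    rw [div_mul_eq_mul_div, le_div_iff₀ hκ0]
    linarith

end LimitProcess

/-! ### Limit theorems for i.i.d. samples -/

section LimitTheorems

variable {p : ℕ} {Ω : Type*} [MeasurableSpace Ω] {P : Measure Ω}

/-- The multivariate central limit theorem, from the univariate one through characteristic
functions. -/
theorem tendstoInDistribution_inv_sqrt_smul_sum [IsProbabilityMeasure P] {X : ℕ → Ω → Vec p}
    {B : Matrix (Fin (p + 1)) (Fin (p + 1)) ℝ} (hX : MemLp (X 0) 2 P) (hindep : iIndepFun X P)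
    (hident : ∀ i, IdentDistrib (X i) (X 0) P P) (h0 : ∀ t, ∫ ω, inner ℝ (X 0 ω) t ∂P = 0)
    (hB : B.IsHermitian)
    (hcov : ∀ t : Vec p, ∫ ω, inner ℝ (X 0 ω) t ^ 2 ∂P = t.ofLp ⬝ᵥ B *ᵥ t.ofLp) :
    TendstoInDistribution (fun (n : ℕ) ω => (√(n : ℝ))⁻¹ • ∑ i ∈ Finset.range n, X i ω) atTop id
      (fun _ => P) (multivariateGaussian 0 B) := by
  have hm (i : ℕ) : AEMeasurable (X i) P := (hident i).aemeasurable_fst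
  have hmeas (n : ℕ) : AEMeasurable (fun ω => (√(n : ℝ))⁻¹ • ∑ i ∈ Finset.range n, X i ω) P :=
    (Finset.aemeasurable_fun_sum (Finset.range n) fun i _ => hm i).fun_const_smul (√(n : ℝ))⁻¹
  refine ⟨hmeas, aemeasurable_id, ?_⟩
  have hpsd : B.PosSemidef := .of_dotProduct_mulVec_nonneg hB fun x => by
    have := hcov (WithLp.toLp 2 x)
    simp only [star_trivial]
    rw [← this]
    exact integral_nonneg fun ω => sq_nonneg _
  refine ProbabilityMeasure.tendsto_iff_tendsto_charFun.2 fun t => ?_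
  have hmt : Measurable fun x : Vec p => inner ℝ x t := by fun_prop
  have hvar : Var[fun ω => inner ℝ (X 0 ω) t; P] = t.ofLp ⬝ᵥ B *ᵥ t.ofLp := by
    rw [variance_of_integral_eq_zero (X := fun ω => inner ℝ (X 0 ω) t)
      (hmt.comp_aemeasurable (hm 0)) (h0 t), hcov]
  have hclt := tendstoInDistribution_inv_sqrt_mul_sum_sub (P := P)
    (X := fun i ω => inner ℝ (X i ω) t) (Y := id) (HasLaw.id (μ := gaussianReal 0
      Var[fun ω => inner ℝ (X 0 ω) t; P].toNNReal)) (hX.inner_const t)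
    (hindep.comp (fun _ x => inner ℝ x t) fun _ => hmt) fun i => (hident i).comp hmt
  have hchar := ProbabilityMeasure.tendsto_iff_tendsto_charFun.1 hclt.tendsto 1
  simp only [ProbabilityMeasure.coe_mk, Measure.map_id, charFun_gaussianReal, hvar] at hchar
  simp only [ProbabilityMeasure.coe_mk, Measure.map_id, charFun_multivariateGaussian hpsd]
  convert hchar using 2 with n
  · rw [charFun_apply, charFun_apply, integral_map (hmeas n) (by fun_prop),
      integral_map ?_ (by fun_prop)]
    · refine integral_congr_ae (Eventually.of_forall fun ω => ?_)
      simp only [inner_smul_left, sum_inner, conj_trivial, h0, mul_zero, sub_zero]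
      simp
    · refine AEMeasurable.const_mul (AEMeasurable.sub_const ?_ _) _
      exact Finset.aemeasurable_fun_sum _ fun i _ => hmt.comp_aemeasurable (hm i)
  · have : (0 : ℝ) ≤ t.ofLp ⬝ᵥ B *ᵥ t.ofLp := by simpa using hpsd.dotProduct_mulVec_nonneg t.ofLp
    simp [Real.coe_toNNReal _ this]

/-- The strong law of large numbers, for integrable functions of an i.i.d. sample. -/
theorem ae_tendsto_mean {Z : Type*} [MeasurableSpace Z] {Q : Measure Z} {z : ℕ → Ω → Z}
    (hz_law : ∀ i, HasLaw (z i) Q P) (hz_indep : iIndepFun z P) {f : Z → ℝ}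
    (hf : Integrable f Q) :
    ∀ᵐ ω ∂P, Tendsto (fun n : ℕ => (n : ℝ)⁻¹ * ∑ i ∈ Finset.range n, f (z i ω)) atTop
      (𝓝 (∫ x, f x ∂Q)) := by
  have hm (i : ℕ) : AEMeasurable f (P.map (z i)) := by
    rw [(hz_law i).map_eq]; exact hf.aemeasurable
  have hint : Integrable (fun ω => f (z 0 ω)) P := by
    have := hf
    rw [← (hz_law 0).map_eq] at this
    exact this.comp_aemeasurable (hz_law 0).aemeasurable
  have hindep : iIndepFun (fun i ω => f (z i ω)) P :=
    hz_indep.comp₀ (fun _ => f) (fun i => (hz_law i).aemeasurable) hm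
  have := strong_law_ae (μ := P) (fun i ω => f (z i ω)) hint
    (fun i j hij => hindep.indepFun hij)
    (fun i => ((hz_law i).identDistrib (hz_law 0)).comp_of_aemeasurable (hm i))
  rwa [show ∫ x, f x ∂Q = ∫ ω, f (z 0 ω) ∂P from
    ((hz_law 0).integral_comp hf.aestronglyMeasurable).symm]

lemma aemeasurable_mean {Z : Type*} [MeasurableSpace Z] {Q : Measure Z} {z : ℕ → Ω → Z}
    (hz_law : ∀ i, HasLaw (z i) Q P) {f : Z → ℝ} (hf : AEMeasurable f Q) (n : ℕ) :
    AEMeasurable (fun ω => (n : ℝ)⁻¹ * ∑ i ∈ Finset.range n, f (z i ω)) P := by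
  refine (Finset.aemeasurable_fun_sum _ fun i _ => ?_).const_mul _
  refine AEMeasurable.comp_aemeasurable (g := f) ?_ (hz_law i).aemeasurable
  rwa [(hz_law i).map_eq]

end LimitTheorems

/-! ### Asymptotic distribution of penalized minimizers of a random loss -/

section Estimator

variable {p : ℕ} {Z : Type*} [MeasurableSpace Z] {Q : Measure Z} {ℓ : Z → Vec p → ℝ}
  {x₀ : Vec p} {η : ℝ} {S : Z → ℝ}

namespace RegularLoss

lemma integral_inner_gradient_sq [IsProbabilityMeasure Q] (h : RegularLoss Q ℓ x₀ η S)
    (t : Vec p) : ∫ z, inner ℝ (gradient (ℓ z) x₀) t ^ 2 ∂Q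
      = t.ofLp ⬝ᵥ gradientCov Q ℓ x₀ *ᵥ t.ofLp := by
  have hexp (z : Z) : inner ℝ (gradient (ℓ z) x₀) t ^ 2
      = ∑ j, ∑ k, gradient (ℓ z) x₀ j * gradient (ℓ z) x₀ k * (t j * t k) := by
    rw [PiLp.inner_apply, sq, Finset.sum_mul_sum]
    refine Finset.sum_congr rfl fun j _ => Finset.sum_congr rfl fun k _ => ?_
    simp only [RCLike.inner_apply, conj_trivial]
    ring
  simp_rw [hexp, dotProduct_mulVec_eq_sum]
  rw [integral_finsetSum _ fun j _ => integrable_finsetSum _ fun k _ =>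
    (h.integrable_gradient_mul j k).mul_const _]
  refine Finset.sum_congr rfl fun j _ => ?_
  rw [integral_finsetSum _ fun k _ => (h.integrable_gradient_mul j k).mul_const _]
  exact Finset.sum_congr rfl fun k _ => integral_mul_const _ _

lemma gradientCov_isHermitian (Q : Measure Z) (ℓ : Z → Vec p → ℝ) (x₀ : Vec p) :
    (gradientCov Q ℓ x₀).IsHermitian := by
  ext j k
  simp [gradientCov, mul_comm]

end RegularLoss

/-- The normalized sum of gradients, `n^{-1/2} ∑_{i<n} ∇ℓ(zᵢ, x₀)`. -/
noncomputable def score (ℓ : Z → Vec p → ℝ) (x₀ : Vec p) (n : ℕ) (z : ℕ → Z) : Vec p :=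
  (√(n : ℝ))⁻¹ • ∑ i ∈ Finset.range n, gradient (ℓ (z i)) x₀

/-- The distance between the empirical and the expected Hessian matrix. -/
noncomputable def hessianError (Q : Measure Z) (ℓ : Z → Vec p → ℝ) (x₀ : Vec p) (n : ℕ)
    (z : ℕ → Z) : ℝ :=
  ∑ j, ∑ k, |(n : ℝ)⁻¹ * ∑ i ∈ Finset.range n, opMatrix (fderiv ℝ (gradient (ℓ (z i))) x₀) j k
    - RegularLoss.meanHessian Q ℓ x₀ j k|

/-- The rescaled increment of the penalized criterion, as a function of the local parameter
`w = √n (β - x₀)`. -/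
noncomputable def localCriterion (ℓ : Z → Vec p → ℝ) (f : Vec p → ℝ) (x₀ : Vec p) (n : ℕ)
    (z : ℕ → Z) (lam : ℝ) (w : Vec p) : ℝ :=
  ∑ i ∈ Finset.range n, (ℓ (z i) (x₀ + (√(n : ℝ))⁻¹ • w) - ℓ (z i) x₀)
    + n * lam * (f (x₀ + (√(n : ℝ))⁻¹ • w) - f x₀)

lemma sum_loss_sub_eq {Y : Type*} {ℓ : Y → Vec p → ℝ} (n : ℕ) (z : ℕ → Y) (w : Vec p) :
    ∑ i ∈ Finset.range n, (ℓ (z i) (x₀ + (√(n : ℝ))⁻¹ • w) - ℓ (z i) x₀)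
      = inner ℝ w (score ℓ x₀ n z)
        + 1 / 2 * ((n : ℝ)⁻¹ * ∑ i ∈ Finset.range n,
            inner ℝ (fderiv ℝ (gradient (ℓ (z i))) x₀ w) w)
        + ∑ i ∈ Finset.range n, taylorRem (ℓ (z i)) x₀ ((√(n : ℝ))⁻¹ • w) := by
  have hs : (√(n : ℝ))⁻¹ * (√(n : ℝ))⁻¹ = (n : ℝ)⁻¹ := by
    rw [← mul_inv, Real.mul_self_sqrt n.cast_nonneg]
  have h1 (i : ℕ) : ℓ (z i) (x₀ + (√(n : ℝ))⁻¹ • w) - ℓ (z i) x₀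
      = (√(n : ℝ))⁻¹ * inner ℝ w (gradient (ℓ (z i)) x₀)
        + 1 / 2 * ((n : ℝ)⁻¹ * inner ℝ (fderiv ℝ (gradient (ℓ (z i))) x₀ w) w)
        + taylorRem (ℓ (z i)) x₀ ((√(n : ℝ))⁻¹ • w) := by
    rw [taylorRem, map_smul, inner_smul_left, inner_smul_right, inner_smul_right, ← hs,
      real_inner_comm (gradient (ℓ (z i)) x₀) w, conj_trivial]
    ring
  simp_rw [h1, Finset.sum_add_distrib, ← Finset.mul_sum, score, inner_smul_right, inner_sum]

lemma abs_mean_hessian_sub_le (n : ℕ) (z : ℕ → Z) (w : Vec p) :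
    |(n : ℝ)⁻¹ * ∑ i ∈ Finset.range n, inner ℝ (fderiv ℝ (gradient (ℓ (z i))) x₀ w) w
      - w.ofLp ⬝ᵥ RegularLoss.meanHessian Q ℓ x₀ *ᵥ w.ofLp|
      ≤ hessianError Q ℓ x₀ n z * ‖w‖ ^ 2 := by
  have h1 : (n : ℝ)⁻¹ * ∑ i ∈ Finset.range n, inner ℝ (fderiv ℝ (gradient (ℓ (z i))) x₀ w) w
      - w.ofLp ⬝ᵥ RegularLoss.meanHessian Q ℓ x₀ *ᵥ w.ofLp
      = ∑ j, ∑ k, ((n : ℝ)⁻¹ * ∑ i ∈ Finset.range n,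
          opMatrix (fderiv ℝ (gradient (ℓ (z i))) x₀) j k
          - RegularLoss.meanHessian Q ℓ x₀ j k) * (w j * w k) := by
    simp_rw [inner_apply_self_eq, dotProduct_mulVec_eq_sum, sub_mul, Finset.sum_sub_distrib]
    congr 1
    rw [Finset.sum_comm, Finset.mul_sum]
    refine Finset.sum_congr rfl fun j _ => ?_
    rw [Finset.sum_comm, Finset.mul_sum]
    refine Finset.sum_congr rfl fun k _ => ?_
    rw [← Finset.sum_mul, mul_assoc]
  rw [h1, hessianError, Finset.sum_mul]
  refine (Finset.abs_sum_le_sum_abs _ _).trans (Finset.sum_le_sum fun j _ => ?_)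
  rw [Finset.sum_mul]
  refine (Finset.abs_sum_le_sum_abs _ _).trans (Finset.sum_le_sum fun k _ => ?_)
  rw [abs_mul, abs_mul, sq]
  gcongr
  · exact PiLp.norm_apply_le w j
  · exact PiLp.norm_apply_le w k

/-- The local criterion is close to the limit process with `w₀` equal to the score. -/
lemma abs_localCriterion_sub_le {n : ℕ} (hn : 1 ≤ n) {z : ℕ → Z} {f : Vec p → ℝ}
    {q : Vec p → Vec p} {b C ε δ lam : ℝ} {r : Z → ℝ} {w : Vec p}
    (hC : |inner ℝ w (q w)| ≤ C * ‖w‖) (hhom : inner ℝ ((√(n : ℝ))⁻¹ • w) (q ((√(n : ℝ))⁻¹ • w))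
      = (√(n : ℝ))⁻¹ * inner ℝ w (q w))
    (hf : ∀ u, ‖u‖ < δ → |f (x₀ + u) - f x₀ - inner ℝ u (q u)| ≤ ε * ‖u‖)
    (hr : ∀ i, ∀ u, ‖u‖ < δ → |taylorRem (ℓ (z i)) x₀ u| ≤ r (z i) * ‖u‖ ^ 2)
    (hw : ‖w‖ < δ * √(n : ℝ)) :
    |localCriterion ℓ f x₀ n z lam w
      - R (RegularLoss.meanHessian Q ℓ x₀) b q (score ℓ x₀ n z) w|
      ≤ (hessianError Q ℓ x₀ n z + (n : ℝ)⁻¹ * ∑ i ∈ Finset.range n, r (z i)) * ‖w‖ ^ 2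
        + (|√(n : ℝ) * lam - b| * C + |√(n : ℝ) * lam| * ε) * ‖w‖ := by
  have hn0 : (0 : ℝ) < n := by exact_mod_cast hn
  have hsq : 0 < √(n : ℝ) := Real.sqrt_pos.2 hn0
  have hss : √(n : ℝ) * √(n : ℝ) = n := Real.mul_self_sqrt hn0.le
  set u := (√(n : ℝ))⁻¹ • w with hu
  have hun : ‖u‖ = (√(n : ℝ))⁻¹ * ‖w‖ := by
    rw [hu, norm_smul, norm_inv, Real.norm_of_nonneg hsq.le]
  have hun2 : ‖u‖ ^ 2 = (n : ℝ)⁻¹ * ‖w‖ ^ 2 := by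
    rw [hun, mul_pow, inv_pow, Real.sq_sqrt hn0.le]
  have huδ : ‖u‖ < δ := by
    rw [hun, inv_mul_lt_iff₀ hsq]
    linarith
  have hrem : |∑ i ∈ Finset.range n, taylorRem (ℓ (z i)) x₀ u|
      ≤ ((n : ℝ)⁻¹ * ∑ i ∈ Finset.range n, r (z i)) * ‖w‖ ^ 2 := by
    refine (Finset.abs_sum_le_sum_abs _ _).trans ?_
    calc _ ≤ ∑ i ∈ Finset.range n, r (z i) * ‖u‖ ^ 2 :=
          Finset.sum_le_sum fun i _ => hr i u huδ
      _ = _ := by rw [← Finset.sum_mul, hun2]; ring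
  have hH := abs_mean_hessian_sub_le (Q := Q) (ℓ := ℓ) (x₀ := x₀) n z w
  have hH0 : 0 ≤ hessianError Q ℓ x₀ n z := by unfold hessianError; positivity
  -- the penalty, with `e` the error of its expansion
  obtain ⟨e, he⟩ : ∃ e, e = f (x₀ + u) - f x₀ - inner ℝ u (q u) := ⟨_, rfl⟩
  have hpen : n * lam * (f (x₀ + u) - f x₀)
      = √(n : ℝ) * lam * inner ℝ w (q w) + √(n : ℝ) * lam * (√(n : ℝ) * e) := by
    have : f (x₀ + u) - f x₀ = (√(n : ℝ))⁻¹ * inner ℝ w (q w) + e := by rw [he, hhom]; ring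
    have hns : (n : ℝ) * (√(n : ℝ))⁻¹ = √(n : ℝ) := by
      nth_rewrite 1 [← hss]
      rw [mul_inv_cancel_right₀ hsq.ne']
    rw [this]
    linear_combination (lam * inner ℝ w (q w)) * hns - lam * e * hss
  have hpe : |√(n : ℝ) * lam * (√(n : ℝ) * e)| ≤ |√(n : ℝ) * lam| * ε * ‖w‖ := by
    rw [abs_mul _ (√(n : ℝ) * e), mul_assoc]
    gcongr
    rw [abs_mul, abs_of_pos hsq]
    have h1 : |e| ≤ ε * ‖u‖ := he ▸ hf u huδ
    calc √(n : ℝ) * |e| ≤ √(n : ℝ) * (ε * ‖u‖) := by gcongr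
      _ = ε * ‖w‖ := by rw [hun]; field_simp
  have hpd : |(√(n : ℝ) * lam - b) * inner ℝ w (q w)| ≤ |√(n : ℝ) * lam - b| * C * ‖w‖ := by
    rw [abs_mul, mul_assoc]
    gcongr
  rw [localCriterion, sum_loss_sub_eq, ← hu, hpen, R]
  set H := (n : ℝ)⁻¹ * ∑ i ∈ Finset.range n, inner ℝ (fderiv ℝ (gradient (ℓ (z i))) x₀ w) w
  set Aw := w.ofLp ⬝ᵥ RegularLoss.meanHessian Q ℓ x₀ *ᵥ w.ofLp
  have hH' : |1 / 2 * (H - Aw)| ≤ hessianError Q ℓ x₀ n z * ‖w‖ ^ 2 := by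
    rw [abs_mul, abs_of_pos (by norm_num : (0 : ℝ) < 1 / 2)]
    linarith [abs_nonneg (H - Aw)]
  calc _ = |1 / 2 * (H - Aw) + ∑ i ∈ Finset.range n, taylorRem (ℓ (z i)) x₀ u
        + (√(n : ℝ) * lam - b) * inner ℝ w (q w) + √(n : ℝ) * lam * (√(n : ℝ) * e)| := by
          congr 1; ring
    _ ≤ |1 / 2 * (H - Aw)| + |∑ i ∈ Finset.range n, taylorRem (ℓ (z i)) x₀ u|
        + |(√(n : ℝ) * lam - b) * inner ℝ w (q w)| + |√(n : ℝ) * lam * (√(n : ℝ) * e)| :=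
          (abs_add_le _ _).trans (add_le_add_left ((abs_add_le _ _).trans
            (add_le_add_left (abs_add_le _ _) _)) _)
    _ ≤ _ := by linarith

lemma localCriterion_le_of_minimizer {Y : Type*} {ℓ : Y → Vec p → ℝ} {n : ℕ} (hn : 1 ≤ n)
    {z : ℕ → Y} {f : Vec p → ℝ}
    {lam : ℝ} {βh : Vec p}
    (hmin : ∀ β, 1 / (n : ℝ) * ∑ i ∈ Finset.range n, ℓ (z i) βh + lam * f βh
      ≤ 1 / (n : ℝ) * ∑ i ∈ Finset.range n, ℓ (z i) β + lam * f β) (w : Vec p) :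
    localCriterion ℓ f x₀ n z lam (√(n : ℝ) • (βh - x₀)) ≤ localCriterion ℓ f x₀ n z lam w := by
  have hn0 : (0 : ℝ) < n := by exact_mod_cast hn
  have hsq : √(n : ℝ) ≠ 0 := (Real.sqrt_pos.2 hn0).ne'
  have h1 := mul_le_mul_of_nonneg_left (hmin (x₀ + (√(n : ℝ))⁻¹ • w)) hn0.le
  simp only [localCriterion, smul_smul, inv_mul_cancel₀ hsq, one_smul, add_sub_cancel,
    Finset.sum_sub_distrib]
  simp only [mul_add, ← mul_assoc, mul_one_div_cancel hn0.ne', one_mul] at h1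
  linarith

/-- The function `w ↦ ⟨w, q w⟩` is a convex and positively homogeneous first-order expansion of the
penalty `f` at `x₀`. -/
structure IsPenaltyTangent (f : Vec p → ℝ) (x₀ : Vec p) (q : Vec p → Vec p) : Prop where
  convexOn : ConvexOn ℝ univ fun w => inner ℝ w (q w)
  continuous : Continuous fun w => inner ℝ w (q w)
  exists_bound : ∃ C, 0 ≤ C ∧ ∀ w, |inner ℝ w (q w)| ≤ C * ‖w‖
  homogeneous : ∀ s > 0, ∀ w, inner ℝ (s • w) (q (s • w)) = s * inner ℝ w (q w)
  expansion : ∀ ε > 0, ∃ δ > 0, ∀ w, ‖w‖ < δ →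
    |f (x₀ + w) - f x₀ - inner ℝ w (q w)| ≤ ε * ‖w‖

variable {Ω : Type*} [MeasurableSpace Ω] {P : Measure Ω} {z : ℕ → Ω → Z}

lemma tendstoInDistribution_score [IsProbabilityMeasure P] [IsProbabilityMeasure Q]
    (h : RegularLoss Q ℓ x₀ η S)
    (hmin : ∀ β, ∫ z, ℓ z x₀ ∂Q ≤ ∫ z, ℓ z β ∂Q)
    (hz_law : ∀ i, HasLaw (z i) Q P) (hz_indep : iIndepFun z P) :
    TendstoInDistribution (fun n ω => score ℓ x₀ n fun i => z i ω) atTop id (fun _ => P)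
      (multivariateGaussian 0 (RegularLoss.gradientCov Q ℓ x₀)) := by
  have hg := h.aemeasurable_gradient (Metric.mem_closedBall_self h.pos.le)
  have hm (i : ℕ) : AEMeasurable (fun y => gradient (ℓ y) x₀) (P.map (z i)) := by
    rwa [(hz_law i).map_eq]
  refine tendstoInDistribution_inv_sqrt_smul_sum
    (X := fun i ω => gradient (ℓ (z i ω)) x₀) ?_ ?_ (fun i => ?_) (fun t => ?_)
    (RegularLoss.gradientCov_isHermitian Q ℓ x₀) (fun t => ?_)
  · have := h.memLp_gradient
    rw [← (hz_law 0).map_eq] at this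
    exact this.comp_of_map (hz_law 0).aemeasurable
  · exact hz_indep.comp₀ (fun _ y => gradient (ℓ y) x₀) (fun i => (hz_law i).aemeasurable) hm
  · exact ((hz_law i).identDistrib (hz_law 0)).comp_of_aemeasurable (hm i)
  · rw [← h.integral_inner_gradient_eq_zero hmin t]
    exact (hz_law 0).integral_comp (f := fun y => inner ℝ (gradient (ℓ y) x₀) t)
      (h.memLp_inner_gradient t).aestronglyMeasurable
  · rw [← h.integral_inner_gradient_sq t]
    exact (hz_law 0).integral_comp (f := fun y => inner ℝ (gradient (ℓ y) x₀) t ^ 2)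
      ((h.memLp_inner_gradient t).aestronglyMeasurable.pow 2)

/-- The error in the quadratic expansion of the empirical loss, with the Taylor remainders bounded
through `r`, converges in probability. -/
lemma tendstoInMeasure_expansionError [IsProbabilityMeasure P] (h : RegularLoss Q ℓ x₀ η S)
    (hz_law : ∀ i, HasLaw (z i) Q P) (hz_indep : iIndepFun z P) {r : Z → ℝ}
    (hr : Integrable r Q) :
    TendstoInMeasure P (fun (n : ℕ) ω => hessianError Q ℓ x₀ n (fun i => z i ω)
      + (n : ℝ)⁻¹ * ∑ i ∈ Finset.range n, r (z i ω)) atTop (fun _ => ∫ y, r y ∂Q) := by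
  refine tendstoInMeasure_of_tendsto_ae (fun n => ?_) ?_
  · refine (AEMeasurable.add ?_ (aemeasurable_mean hz_law hr.aemeasurable n)).aestronglyMeasurable
    refine Finset.aemeasurable_fun_sum _ fun j _ => Finset.aemeasurable_fun_sum _ fun k _ => ?_
    exact ((aemeasurable_mean hz_law (h.integrable_opMatrix_hessian j k).aemeasurable n).sub_const
      _).norm
  · have hH : ∀ᵐ ω ∂P, ∀ j k, Tendsto (fun n : ℕ => (n : ℝ)⁻¹ * ∑ i ∈ Finset.range n,
        opMatrix (fderiv ℝ (gradient (ℓ (z i ω))) x₀) j k) atTop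
        (𝓝 (RegularLoss.meanHessian Q ℓ x₀ j k)) :=
      ae_all_iff.2 fun j => ae_all_iff.2 fun k =>
        ae_tendsto_mean hz_law hz_indep (h.integrable_opMatrix_hessian j k)
    filter_upwards [hH, ae_tendsto_mean hz_law hz_indep hr] with ω h1 h2
    have h3 : Tendsto (fun n : ℕ => hessianError Q ℓ x₀ n (fun i => z i ω)) atTop (𝓝 0) := by
      have : Tendsto (fun n : ℕ => hessianError Q ℓ x₀ n (fun i => z i ω)) atTop
          (𝓝 (∑ _j : Fin (p + 1), ∑ _k : Fin (p + 1), (0 : ℝ))) :=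
        tendsto_finsetSum _ fun j _ => tendsto_finsetSum _ fun k _ => by
          have := ((h1 j k).sub_const (RegularLoss.meanHessian Q ℓ x₀ j k)).abs
          rwa [sub_self, abs_zero] at this
      simpa using this
    simpa using h3.add h2

/-- **Asymptotic distribution of a penalized minimizer.** The localized estimator is asymptotically
equivalent to the minimizer of the limit process evaluated at the score. -/
theorem tendstoInMeasure_sub_minimizer [IsProbabilityMeasure P] [IsProbabilityMeasure Q]
    (h : RegularLoss Q ℓ x₀ η S) (hz_law : ∀ i, HasLaw (z i) Q P) (hz_indep : iIndepFun z P)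
    {κ : ℝ} (hκ0 : 0 < κ)
    (hκ : ∀ w : Vec p, κ * ‖w‖ ^ 2 ≤ w.ofLp ⬝ᵥ RegularLoss.meanHessian Q ℓ x₀ *ᵥ w.ofLp)
    {f : Vec p → ℝ} {q : Vec p → Vec p} (hq : IsPenaltyTangent f x₀ q)
    {lam : ℕ → Ω → ℝ} {βhat : ℕ → Ω → Vec p}
    (hβhat : ∀ n : ℕ, 1 ≤ n → ∀ᵐ ω ∂P, ∀ β,
      1 / (n : ℝ) * ∑ i ∈ Finset.range n, ℓ (z i ω) (βhat n ω) + lam n ω * f (βhat n ω)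
        ≤ 1 / (n : ℝ) * ∑ i ∈ Finset.range n, ℓ (z i ω) β + lam n ω * f β)
    (hrate : BoundedInProb P (fun (n : ℕ) ω => √(n : ℝ) • (βhat n ω - x₀)))
    {b : ℝ} (hb : 0 ≤ b)
    (hlam : TendstoInMeasure P (fun (n : ℕ) ω => √(n : ℝ) * lam n ω) atTop (fun _ => b))
    {W : Vec p → Vec p} (hW : ∀ w₀ w, R (RegularLoss.meanHessian Q ℓ x₀) b q w₀ (W w₀)
      ≤ R (RegularLoss.meanHessian Q ℓ x₀) b q w₀ w) :
    TendstoInMeasure P ((fun (n : ℕ) ω => √(n : ℝ) • (βhat n ω - x₀))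
      - fun n ω => W (score ℓ x₀ n fun i => z i ω)) atTop 0 := by
  rw [tendstoInMeasure_iff_norm]
  intro τ hτ
  simp only [Pi.sub_apply, Pi.zero_apply, sub_zero]
  refine ENNReal.tendsto_nhds_zero.2 fun ε' hε' => ?_
  have hε3 : 0 < ε' / 3 := ENNReal.div_pos hε'.ne' (by simp)
  obtain ⟨C₀, hC₀⟩ := hrate (ε' / 3) hε3
  obtain ⟨C, hC0, hC⟩ := hq.exists_bound
  -- all comparisons take place in the ball of radius `ϱ`
  set ϱ := max C₀ 0 + τ with hϱ
  have hϱ0 : 0 < ϱ := by positivity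
  set K := 2 * ϱ ^ 2 + (C + (b + 1)) * ϱ with hK
  have hK0 : 0 < K := by positivity
  -- the approximation error on this ball is then at most `κ τ² / 16`
  set ε := min 1 (κ * τ ^ 2 / 16 / K) with hε
  have hε0 : 0 < ε := by positivity
  have hεK : ε * K ≤ κ * τ ^ 2 / 16 := by
    rw [← le_div_iff₀ hK0]; exact min_le_right _ _
  obtain ⟨δ₁, hδ₁, r, hr, hrε, hrem⟩ := h.exists_remainder_bound hε0
  obtain ⟨δ₂, hδ₂, hfexp⟩ := hq.expansion ε hε0
  have hA := (tendstoInMeasure_iff_norm.1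
    (tendstoInMeasure_expansionError h hz_law hz_indep hr)) ε hε0
  have hL := (tendstoInMeasure_iff_norm.1 hlam) ε hε0
  have hn : ∀ᶠ n : ℕ in atTop, ϱ / min δ₁ δ₂ < √(n : ℝ) :=
    (Real.tendsto_sqrt_atTop.comp (tendsto_natCast_atTop_atTop (R := ℝ))).eventually_gt_atTop _
  have hremP : ∀ᵐ ω ∂P, ∀ i, ∀ w, ‖w‖ < δ₁ →
      |taylorRem (ℓ (z i ω)) x₀ w| ≤ r (z i ω) * ‖w‖ ^ 2 := by
    refine ae_all_iff.2 fun i => ?_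
    rw [← (hz_law i).map_eq] at hrem
    exact ae_of_ae_map (hz_law i).aemeasurable hrem
  filter_upwards [hC₀, ENNReal.tendsto_nhds_zero.1 hA _ hε3, ENNReal.tendsto_nhds_zero.1 hL _ hε3,
    hn, eventually_ge_atTop 1] with n h1 h2 h3 hnδ hn1
  calc P {ω | τ ≤ ‖√(n : ℝ) • (βhat n ω - x₀) - W (score ℓ x₀ n fun i => z i ω)‖}
      ≤ P ({ω | C₀ < ‖√(n : ℝ) • (βhat n ω - x₀)‖}
        ∪ {ω | ε ≤ ‖hessianError Q ℓ x₀ n (fun i => z i ω)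
          + (n : ℝ)⁻¹ * ∑ i ∈ Finset.range n, r (z i ω) - ∫ y, r y ∂Q‖}
        ∪ {ω | ε ≤ ‖√(n : ℝ) * lam n ω - b‖}) := by
        refine measure_mono_ae ?_
        filter_upwards [hβhat n hn1, hremP] with ω hω hrω hτω
        by_contra hbad
        have hτω' : τ ≤ ‖√(n : ℝ) • (βhat n ω - x₀) - W (score ℓ x₀ n fun i => z i ω)‖ := hτω
        replace hbad : ¬ ((C₀ < ‖√(n : ℝ) • (βhat n ω - x₀)‖ ∨
          ε ≤ ‖hessianError Q ℓ x₀ n (fun i => z i ω)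
          + (n : ℝ)⁻¹ * ∑ i ∈ Finset.range n, r (z i ω) - ∫ y, r y ∂Q‖) ∨
          ε ≤ ‖√(n : ℝ) * lam n ω - b‖) := hbad
        push Not at hbad
        obtain ⟨⟨b1, b2⟩, b3⟩ := hbad
        set x := √(n : ℝ) • (βhat n ω - x₀) with hx
        set G := score ℓ x₀ n fun i => z i ω with hG
        obtain ⟨w, hwx, hwΦ⟩ := exists_improvement_of_strongConvexOn
          (strongConvexOn_R hκ hb hq.convexOn G) hκ0 (hW G) hτ hτω'
        have hcrit : localCriterion ℓ f x₀ n (fun i => z i ω) (lam n ω) x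
            ≤ localCriterion ℓ f x₀ n (fun i => z i ω) (lam n ω) w :=
          localCriterion_le_of_minimizer hn1 (z := fun i => z i ω) hω w
        have happrox (u : Vec p) (hu : ‖u‖ ≤ ϱ) :
            |localCriterion ℓ f x₀ n (fun i => z i ω) (lam n ω) u
              - R (RegularLoss.meanHessian Q ℓ x₀) b q G u| ≤ κ * τ ^ 2 / 16 := by
          have hδ : 0 < min δ₁ δ₂ := lt_min hδ₁ hδ₂
          have hu' : ‖u‖ < min δ₁ δ₂ * √(n : ℝ) := by
            rw [div_lt_iff₀ hδ] at hnδ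
            linarith
          have hsn : 0 < (√(n : ℝ))⁻¹ := inv_pos.2 (Real.sqrt_pos.2 (by exact_mod_cast hn1))
          refine (abs_localCriterion_sub_le (z := fun i => z i ω) (δ := min δ₁ δ₂) (r := r) hn1
            (hC u) (hq.homogeneous _ hsn u) (fun v hv => hfexp v (hv.trans_le (min_le_right _ _)))
            (fun i v hv => hrω i v (hv.trans_le (min_le_left _ _))) hu').trans ?_
          refine le_trans ?_ hεK
          rw [Real.norm_eq_abs] at b2 b3
          have hlamb : |√(n : ℝ) * lam n ω| ≤ b + 1 := by
            have : |√(n : ℝ) * lam n ω| ≤ |√(n : ℝ) * lam n ω - b| + |b| := by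
              simpa using abs_add_le (√(n : ℝ) * lam n ω - b) b
            rw [abs_of_nonneg hb] at this
            linarith [min_le_left 1 (κ * τ ^ 2 / 16 / K)]
          have t1 : (hessianError Q ℓ x₀ n (fun i => z i ω)
              + (n : ℝ)⁻¹ * ∑ i ∈ Finset.range n, r (z i ω)) * ‖u‖ ^ 2 ≤ 2 * ε * ϱ ^ 2 := by
            have := (abs_lt.1 b2).2
            calc _ ≤ 2 * ε * ‖u‖ ^ 2 := by gcongr; linarith
              _ ≤ _ := by gcongr
          have t2 : (|√(n : ℝ) * lam n ω - b| * C + |√(n : ℝ) * lam n ω| * ε) * ‖u‖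
              ≤ (ε * C + (b + 1) * ε) * ϱ := by gcongr
          calc _ ≤ 2 * ε * ϱ ^ 2 + (ε * C + (b + 1) * ε) * ϱ := add_le_add t1 t2
            _ = ε * K := by rw [hK]; ring
        have hxϱ : ‖x‖ ≤ ϱ := by linarith [le_max_left C₀ 0]
        have hwϱ : ‖w‖ ≤ ϱ := by
          have : ‖w‖ ≤ ‖w - x‖ + ‖x‖ := by simpa using norm_add_le (w - x) x
          linarith [le_max_left C₀ 0]
        have a1 := (abs_le.1 (happrox x hxϱ)).1
        have a2 := (abs_le.1 (happrox w hwϱ)).2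
        have : 0 < κ * τ ^ 2 := by positivity
        linarith
    _ ≤ ε' / 3 + ε' / 3 + ε' / 3 :=
        (measure_union_le _ _).trans (add_le_add ((measure_union_le _ _).trans
          (add_le_add h1 h2)) h3)
    _ = ε' := ENNReal.add_thirds ε'

end Estimator

/-! ### First-order expansions of the penalties -/

section PenaltyTangent

variable {p : ℕ} {T : Finset (Fin (p + 1))} {x : Vec p}

lemma isPenaltyTangent_of_eq {f : Vec p → ℝ} {q : Vec p → Vec p} {a c : Fin (p + 1) → ℝ}
    (hc : ∀ l, 0 ≤ c l) (hq : ∀ w, inner ℝ w (q w) = ∑ l ∈ T, (a l * w l + c l * |w l|))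
    (hf : (fun w : Vec p => f (x + w) - f x - ∑ l ∈ T, (a l * w l + c l * |w l|))
      =o[𝓝 0] fun w => w) :
    IsPenaltyTangent f x q where
  convexOn := by
    simp_rw [hq]
    refine ⟨convex_univ, fun u _ v _ s t hs ht _ => ?_⟩
    simp only [smul_eq_mul, Finset.mul_sum, ← Finset.sum_add_distrib]
    refine Finset.sum_le_sum fun l _ => ?_
    have h1 : |s * u l + t * v l| ≤ s * |u l| + t * |v l| := by
      simpa [abs_mul, abs_of_nonneg hs, abs_of_nonneg ht] using abs_add_le (s * u l) (t * v l)
    have h2 := mul_le_mul_of_nonneg_left h1 (hc l)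
    simp only [PiLp.add_apply, PiLp.smul_apply, smul_eq_mul]
    linarith
  continuous := by simp_rw [hq]; fun_prop
  exists_bound := by
    refine ⟨∑ l ∈ T, (|a l| + c l), Finset.sum_nonneg fun l _ =>
      add_nonneg (abs_nonneg _) (hc l), fun w => ?_⟩
    rw [hq, Finset.sum_mul]
    refine (Finset.abs_sum_le_sum_abs _ _).trans (Finset.sum_le_sum fun l _ => ?_)
    have hw : |w l| ≤ ‖w‖ := PiLp.norm_apply_le w l
    have hcl := hc l
    calc _ ≤ |a l| * |w l| + c l * |w l| := by
          refine (abs_add_le _ _).trans_eq ?_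
          rw [abs_mul, abs_mul, abs_abs, abs_of_nonneg hcl]
      _ ≤ _ := by rw [← add_mul]; gcongr
  homogeneous s hs w := by
    rw [hq, hq, Finset.mul_sum]
    refine Finset.sum_congr rfl fun l _ => ?_
    simp only [PiLp.smul_apply, smul_eq_mul, abs_mul, abs_of_pos hs]
    ring
  expansion ε hε := by
    obtain ⟨δ, hδ, h⟩ := Metric.eventually_nhds_iff_ball.1 (hf.def hε)
    refine ⟨δ, hδ, fun w hw => ?_⟩
    rw [hq]
    exact h w (by simpa using hw)

lemma isBigO_coordinate (l : Fin (p + 1)) : (fun w : Vec p => w l) =O[𝓝 0] fun w => w :=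
  Asymptotics.IsBigO.of_bound 1 (Eventually.of_forall fun w => by
    rw [one_mul]; exact PiLp.norm_apply_le w l)

lemma isLittleO_sum_coordinates {φ : Fin (p + 1) → ℝ → ℝ} {a c : Fin (p + 1) → ℝ}
    (h : ∀ l ∈ T, (fun t : ℝ => φ l (x l + t) - φ l (x l) - (a l * t + c l * |t|))
      =o[𝓝 0] fun t => t) :
    (fun w : Vec p => ∑ l ∈ T, φ l ((x + w) l) - ∑ l ∈ T, φ l (x l)
      - ∑ l ∈ T, (a l * w l + c l * |w l|)) =o[𝓝 0] fun w => w := by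
  simp_rw [← Finset.sum_sub_distrib]
  refine Asymptotics.IsLittleO.fun_sum fun l hl => ?_
  have hlim : Tendsto (fun w : Vec p => w l) (𝓝 0) (𝓝 0) := by
    have : Continuous fun w : Vec p => w l := by fun_prop
    simpa using this.tendsto 0
  exact ((h l hl).comp_tendsto hlim).trans_isBigO (isBigO_coordinate l)

lemma isLittleO_abs (x : ℝ) : (fun t : ℝ => |x + t| - |x|
    - (Real.sign x * t + (if x = 0 then 1 else 0) * |t|)) =o[𝓝 0] fun t => t := by
  refine Asymptotics.IsLittleO.congr' (Asymptotics.isLittleO_zero _ _) ?_ EventuallyEq.rfl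
  rcases lt_trichotomy x 0 with hx | rfl | hx
  · filter_upwards [eventually_lt_nhds (show (0 : ℝ) < -x by linarith)] with t ht
    rw [abs_of_neg hx, abs_of_neg (by linarith), Real.sign_of_neg hx, if_neg hx.ne]
    ring
  · exact Eventually.of_forall fun t => by simp
  · filter_upwards [eventually_gt_nhds (show -x < (0 : ℝ) by linarith)] with t ht
    rw [abs_of_pos hx, abs_of_pos (by linarith), Real.sign_of_pos hx, if_neg hx.ne']
    ring

lemma isLittleO_of_hasDerivAt {φ : ℝ → ℝ} {φ' x : ℝ} (h : HasDerivAt φ φ' x) :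
    (fun t : ℝ => φ (x + t) - φ x - φ' * t) =o[𝓝 0] fun t => t := by
  simpa [mul_comm] using hasDerivAt_iff_isLittleO_nhds_zero.1 h

lemma inner_sum_single (T : Finset (Fin (p + 1))) (a : Fin (p + 1) → ℝ) (w : Vec p) :
    inner ℝ w (∑ l ∈ T, EuclideanSpace.single l (a l)) = ∑ l ∈ T, a l * w l := by
  simp [inner_sum, EuclideanSpace.inner_single_right]

lemma sign_mul_self_eq_abs (x : ℝ) : Real.sign x * x = |x| := by
  rcases lt_trichotomy x 0 with hx | rfl | hx
  · rw [Real.sign_of_neg hx, abs_of_neg hx]; ring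
  · simp
  · rw [Real.sign_of_pos hx, abs_of_pos hx]; ring

namespace Penalty

lemma eval_eq_mul (T : Finset (Fin (p + 1))) (pen : Penalty) (lam : ℝ) (β : Vec p) :
    pen.eval T lam β = lam * pen.eval T 1 β := by
  cases pen <;> simp [eval]

lemma isPenaltyTangent_elasticNet {α : ℝ} (hα : 0 ≤ α) {f : Vec p → ℝ}
    (hf : ∀ β, f β = ∑ j ∈ T, (1 / 2 * (1 - α) * β j ^ 2 + α * |β j|)) :
    IsPenaltyTangent f x (elasticNetQ T α x) := by
  refine isPenaltyTangent_of_eq (T := T) (a := fun l => (1 - α) * x l + α * Real.sign (x l))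
    (c := fun l => α * if x l = 0 then 1 else 0) (fun l => by positivity) (fun w => ?_) ?_
  · rw [elasticNetQ, inner_sum_single]
    refine Finset.sum_congr rfl fun l _ => ?_
    by_cases hx : x l = 0
    · simp [hx, ← sign_mul_self_eq_abs (w l), mul_assoc]
    · simp [hx]
  · simp_rw [hf]
    refine isLittleO_sum_coordinates (φ := fun _ t => 1 / 2 * (1 - α) * t ^ 2 + α * |t|)
      fun l _ => ?_
    have h1 : HasDerivAt (fun t : ℝ => 1 / 2 * (1 - α) * t ^ 2) ((1 - α) * x l) (x l) := by
      convert! (hasDerivAt_pow 2 (x l)).const_mul (1 / 2 * (1 - α)) using 1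
      simp; ring
    refine ((isLittleO_of_hasDerivAt h1).add ((isLittleO_abs (x l)).const_mul_left α)).congr_left
      fun t => ?_
    ring

lemma isPenaltyTangent_bridge {α : ℝ} (hα : 1 < α) {f : Vec p → ℝ}
    (hf : ∀ β, f β = ∑ j ∈ T, |β j| ^ α) :
    IsPenaltyTangent f x fun _ => bridgeQ T α x := by
  refine isPenaltyTangent_of_eq (T := T)
    (a := fun l => α * (Real.sign (x l) * |x l| ^ (α - 1))) (c := fun _ => 0) (fun l => le_rfl)
    (fun w => ?_) ?_
  · rw [bridgeQ, inner_sum_single]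
    simp
  · simp_rw [hf]
    refine isLittleO_sum_coordinates (φ := fun _ t => |t| ^ α) fun l _ => ?_
    have h1 : HasDerivAt (fun t : ℝ => |t| ^ α) (α * (Real.sign (x l) * |x l| ^ (α - 1)))
        (x l) := by
      convert! hasDerivAt_abs_rpow (x l) hα using 1
      rcases eq_or_ne (x l) 0 with h0 | h0
      · simp [h0]
      · have : |x l| ^ (α - 1) = |x l| ^ (α - 2) * |x l| := by
          rw [← Real.rpow_add_one (abs_ne_zero.2 h0)]
          congr 1; ring
        rw [this]
        have hs : Real.sign (x l) * Real.sign (x l) = 1 := by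
          rcases Real.sign_apply_eq_of_ne_zero (x l) h0 with h | h <;> rw [h] <;> norm_num
        linear_combination (α * |x l| ^ (α - 2) * x l) * hs
          - (α * |x l| ^ (α - 2) * Real.sign (x l)) * sign_mul_self_eq_abs (x l)
    simpa using isLittleO_of_hasDerivAt h1

/-- Product rule for a directionally differentiable factor and a differentiable one. -/
lemma isLittleO_mul {E : Type*} [NormedAddCommGroup E] [NormedSpace ℝ E] {s v D : E → ℝ} {x : E}
    {v' : E →L[ℝ] ℝ} (hs : (fun w => s (x + w) - s x - D w) =o[𝓝 0] fun w => w)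
    (hD : D =O[𝓝 0] fun w => w) (hv : HasFDerivAt v v' x) :
    (fun w => s (x + w) * v (x + w) - s x * v x - (D w * v x + s x * v' w))
      =o[𝓝 0] fun w => w := by
  have hv1 : (fun w => v (x + w) - v x - v' w) =o[𝓝 0] fun w => w :=
    hasFDerivAt_iff_isLittleO_nhds_zero.1 hv
  have hv2 : (fun w => v (x + w) - v x) =o[𝓝 0] fun _ => (1 : ℝ) := by
    rw [Asymptotics.isLittleO_one_iff]
    have : Tendsto (fun w => v (x + w)) (𝓝 0) (𝓝 (v x)) := by
      have h : ContinuousAt v (x + 0) := by rw [add_zero]; exact hv.continuousAt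
      have h2 : ContinuousAt (fun w => v (x + w)) 0 :=
        ContinuousAt.comp (f := fun w => x + w) h (by fun_prop)
      simpa using h2.tendsto
    simpa using this.sub_const (v x)
  have hs1 : (fun w => s (x + w) - s x) =O[𝓝 0] fun w => w := by
    simpa using hs.isBigO.add hD
  have t1 : (fun w => (s (x + w) - s x) * (v (x + w) - v x)) =o[𝓝 0] fun w => ‖w‖ * 1 :=
    hs1.norm_right.mul_isLittleO hv2
  have t1' : (fun w => (s (x + w) - s x) * (v (x + w) - v x)) =o[𝓝 0] fun w => w := by
    simp only [mul_one] at t1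
    exact t1.of_norm_right
  refine ((t1'.add (hs.const_mul_left (v x))).add (hv1.const_mul_left (s x))).congr_left
    fun w => ?_
  ring

lemma hasFDerivAt_inv_subNorm (hx : subNorm T x ≠ 0) :
    ∃ v' : Vec p →L[ℝ] ℝ, HasFDerivAt (fun β : Vec p => (subNorm T β)⁻¹) v' x ∧
      ∀ w, v' w = -(∑ j ∈ T, x j * w j) / subNorm T x ^ 3 := by
  have h1 : HasFDerivAt (fun β : Vec p => ∑ j ∈ T, β j ^ 2)
      (∑ j ∈ T, (2 * x j) • EuclideanSpace.proj (𝕜 := ℝ) j) x := by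
    refine HasFDerivAt.fun_sum fun j _ => ?_
    have := (EuclideanSpace.proj j : Vec p →L[ℝ] ℝ).hasFDerivAt (x := x)
    simpa using this.pow 2
  have hne : ∑ j ∈ T, x j ^ 2 ≠ 0 := fun h => hx (by rw [subNorm, h, Real.sqrt_zero])
  have h2 := ((Real.hasDerivAt_sqrt hne).fun_inv hx).comp_hasFDerivAt x h1
  refine ⟨_, h2, fun w => ?_⟩
  change _ = -(∑ j ∈ T, x j * w j) / √(∑ j ∈ T, x j ^ 2) ^ 3
  have hx' : √(∑ j ∈ T, x j ^ 2) ≠ 0 := hx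
  simp only [FunLike.coe_smul, Pi.smul_apply, _root_.sum_apply, smul_eq_mul,
    PiLp.proj_apply, mul_assoc, ← Finset.mul_sum]
  field_simp

/-- The Lipschitz condition forces the penalized subvector of the true parameter to be nonzero:
the sign penalty jumps from `0` to `1` at a vanishing subvector. -/
lemma subNorm_ne_zero_of_P1 (hP1 : P1 T sign x) (hT : T.Nonempty) : subNorm T x ≠ 0 := by
  intro h0
  obtain ⟨j, hj⟩ := hT
  have hx : ∀ i ∈ T, x i = 0 := by
    have hs : ∑ i ∈ T, x i ^ 2 = 0 := (Real.sqrt_eq_zero (by positivity)).1 h0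
    exact fun i hi => pow_eq_zero_iff two_ne_zero |>.1
      ((Finset.sum_eq_zero_iff_of_nonneg fun i _ => sq_nonneg _).1 hs i hi)
  obtain ⟨ε, hε, K, hK⟩ := hP1
  set s := min (ε / 2) (1 / (|K| + 1) / 2) with hs
  have hs0 : 0 < s := by positivity
  have hsK : |K| * s < 1 := by
    have : s ≤ 1 / (|K| + 1) / 2 := min_le_right _ _
    calc |K| * s ≤ |K| * (1 / (|K| + 1) / 2) := by gcongr
      _ < 1 := by
        have := abs_nonneg K
        field_simp; linarith
  set β := x + EuclideanSpace.single j s with hβ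
  have hβT : ∀ i ∈ T, β i = if i = j then s else 0 := fun i hi => by
    simp [hβ, hx i hi]
  have h1 := hK 1 zero_le_one β (by
    rw [Metric.mem_ball, dist_eq_norm, hβ, add_sub_cancel_left, PiLp.norm_single,
      Real.norm_of_nonneg hs0.le]
    linarith [min_le_left (ε / 2) (1 / (|K| + 1) / 2)]) x (Metric.mem_ball_self hε)
  have e1 : sign.eval T 1 x = 0 := by
    simp [eval, h0]
  have e2 : sign.eval T 1 β = 1 := by
    have ha : ∑ i ∈ T, |β i| = s := by
      rw [Finset.sum_congr rfl fun i hi => by rw [hβT i hi, apply_ite abs, abs_zero]]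
      simp [hj, abs_of_pos hs0]
    have hb : subNorm T β = s := by
      rw [subNorm, Finset.sum_congr rfl fun i hi => by
        rw [hβT i hi, ite_pow, zero_pow two_ne_zero]]
      simp [hj, Real.sqrt_sq hs0.le]
    simp [eval, ha, hb, hs0.ne']
  have e3 : ∑ i, |β i - x i| = s := by
    simp [hβ, apply_ite abs, abs_of_pos hs0]
  rw [e1, e2, e3] at h1
  have : K * s ≤ |K| * s := by gcongr; exact le_abs_self K
  norm_num at h1
  linarith

lemma isPenaltyTangent_sign (hP1 : P1 T sign x) :
    IsPenaltyTangent (sign.eval T 1) x (signQ T x) := by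
  rcases T.eq_empty_or_nonempty with rfl | hT
  · refine isPenaltyTangent_of_eq (T := ∅) (a := 0) (c := 0) (fun _ => le_rfl)
      (fun w => by simp [signQ]) ?_
    simp [eval]
  have hN := subNorm_ne_zero_of_P1 hP1 hT
  have hN0 : 0 ≤ subNorm T x := Real.sqrt_nonneg _
  obtain ⟨v', hv', hv'w⟩ := hasFDerivAt_inv_subNorm hN
  set D : Vec p → ℝ := fun w => ∑ l ∈ T, (Real.sign (x l) * w l
    + (if x l = 0 then 1 else 0) * |w l|) with hD
  have hS : (fun w : Vec p => ∑ l ∈ T, |(x + w) l| - ∑ l ∈ T, |x l| - D w) =o[𝓝 0] fun w => w :=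
    isLittleO_sum_coordinates (φ := fun _ t => |t|) fun l _ => isLittleO_abs (x l)
  have hDO : D =O[𝓝 0] fun w : Vec p => w := by
    refine Asymptotics.IsBigO.fun_sum fun l _ => ?_
    have hl := isBigO_coordinate l
    exact (hl.const_mul_left _).add (hl.norm_left.const_mul_left _)
  have key := isLittleO_mul (s := fun β : Vec p => ∑ l ∈ T, |β l|) hS hDO hv'
  have hcombine (w : Vec p) : D w * (subNorm T x)⁻¹ + (∑ l ∈ T, |x l|) * v' w
      = ∑ l ∈ T, ((Real.sign (x l) / subNorm T x
          - (∑ j ∈ T, |x j|) / subNorm T x ^ 3 * x l) * w l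
        + (if x l = 0 then 1 / subNorm T x else 0) * |w l|) := by
    rw [hv'w, hD, Finset.sum_mul, neg_div, mul_neg, mul_div_assoc', ← sub_eq_add_neg,
      Finset.mul_sum, Finset.sum_div, ← Finset.sum_sub_distrib]
    refine Finset.sum_congr rfl fun l _ => ?_
    split_ifs <;> ring
  refine isPenaltyTangent_of_eq (T := T) (a := fun l => Real.sign (x l) / subNorm T x
    - (∑ j ∈ T, |x j|) / subNorm T x ^ 3 * x l)
    (c := fun l => if x l = 0 then 1 / subNorm T x else 0) (fun l => by positivity)
    (fun w => ?_) ?_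
  · have hterm (l : Fin (p + 1)) : inner ℝ w (if x l ≠ 0 then signGrad T x l
        else EuclideanSpace.single l (Real.sign (w l) / subNorm T x))
        = Real.sign (x l) / subNorm T x * w l + (if x l = 0 then 1 / subNorm T x else 0) * |w l|
          - |x l| * ((∑ j ∈ T, x j * w j) / subNorm T x ^ 3) := by
      by_cases hl : x l = 0
      · simp only [hl, ne_eq, not_true_eq_false, if_false, if_true, Real.sign_zero,
          EuclideanSpace.inner_single_right, conj_trivial, abs_zero]
        rw [← sign_mul_self_eq_abs (w l)]
        ring
      · simp only [hl, ne_eq, not_false_eq_true, if_true, if_false, signGrad, inner_add_right,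
          inner_smul_right, inner_sum_single, EuclideanSpace.inner_single_right, conj_trivial]
        ring
    rw [signQ, inner_sum, Finset.sum_congr rfl fun l _ => hterm l, Finset.sum_sub_distrib,
      ← Finset.sum_mul, Finset.sum_congr rfl fun l _ => show
        (Real.sign (x l) / subNorm T x - (∑ j ∈ T, |x j|) / subNorm T x ^ 3 * x l) * w l
          + (if x l = 0 then 1 / subNorm T x else 0) * |w l|
        = Real.sign (x l) / subNorm T x * w l + (if x l = 0 then 1 / subNorm T x else 0) * |w l|
          - (∑ j ∈ T, |x j|) / subNorm T x ^ 3 * (x l * w l) by ring, Finset.sum_sub_distrib,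
      ← Finset.mul_sum]
    ring
  · refine key.congr_left fun w => ?_
    rw [hcombine]
    simp only [eval, one_mul, div_eq_mul_inv]

/-- The vector `q` of each penalty family gives its first-order expansion. -/
theorem isPenaltyTangent (pen : Penalty) (hpen : pen.Admissible) (hP1 : pen.P1 T x) :
    IsPenaltyTangent (pen.eval T 1) x (pen.q T x) := by
  cases pen with
  | elasticNet α => exact isPenaltyTangent_elasticNet hpen.1 fun β => by simp [eval]
  | bridge α =>
    by_cases hα : α = 1
    · have hq : (bridge α).q T x = elasticNetQ T 1 x := by ext1 w; simp [q, hα]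
      rw [hq]
      exact isPenaltyTangent_elasticNet zero_le_one fun β => by simp [eval, hα]
    · have hq : (bridge α).q T x = fun _ => bridgeQ T α x := by ext1 w; simp [q, hα]
      rw [hq]
      exact isPenaltyTangent_bridge (lt_of_le_of_ne hpen (Ne.symm hα)) fun β => by simp [eval]
  | sign => exact isPenaltyTangent_sign hP1

end Penalty

end PenaltyTangent

/-! ### The loss of the generalized linear model -/

namespace IsRhoFunction

lemma le_one {ρ : ℝ → ℝ} (h : IsRhoFunction ρ) (u : ℝ) : ρ u ≤ 1 := by
  have key (v : ℝ) (hv : 0 ≤ v) : ρ v ≤ 1 := by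
    refine ge_of_tendsto h.tendsto_one ?_
    filter_upwards [eventually_gt_atTop v] with w hw
    exact h.mono v w hv hw
  rcases le_total 0 u with hu | hu
  · exact key u hu
  · rw [h.even]
    exact key (-u) (by linarith)

end IsRhoFunction

namespace Model

variable {M : Model}

lemma ordConnected_range (M : Model) : M.range.OrdConnected :=
  ⟨fun _ hx _ hy _ hz => ⟨hx.1.trans_le (EReal.coe_le_coe_iff.2 hz.1),
    (EReal.coe_le_coe_iff.2 hz.2).trans_lt hy.2⟩⟩

namespace Standing

lemma exists_g_le (hM : M.Standing) (c : ℝ) : ∃ μ ∈ M.range, M.g μ ≤ c := by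
  have h := (eventually_comap.1 (hM.g_atBot.eventually (eventually_le_atBot c))).and
    (Ioo_mem_nhdsGT hM.lt)
  obtain ⟨u, hu, hsub⟩ := (mem_nhdsGT_iff_exists_Ioo_subset' hM.lt).1 h
  obtain ⟨μ, h1, h2⟩ := EReal.lt_iff_exists_real_btwn.1 (show M.μ₁ < u from hu)
  obtain ⟨h3, h4⟩ := hsub ⟨h1, h2⟩
  exact ⟨μ, h4, h3 μ rfl⟩

lemma exists_le_g (hM : M.Standing) (c : ℝ) : ∃ μ ∈ M.range, c ≤ M.g μ := by
  have h := (eventually_comap.1 (hM.g_atTop.eventually (eventually_ge_atTop c))).and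
    (Ioo_mem_nhdsLT hM.lt)
  obtain ⟨u, hu, hsub⟩ := (mem_nhdsLT_iff_exists_Ioo_subset' hM.lt).1 h
  obtain ⟨μ, h1, h2⟩ := EReal.lt_iff_exists_real_btwn.1 (show u < M.μ₂ from hu)
  obtain ⟨h3, h4⟩ := hsub ⟨h1, h2⟩
  exact ⟨μ, h4, h3 μ rfl⟩

lemma mem_image_g (hM : M.Standing) (c : ℝ) : c ∈ M.g '' M.range := by
  obtain ⟨μ, hμ, h1⟩ := hM.exists_g_le c
  obtain ⟨ν, hν, h2⟩ := hM.exists_le_g c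
  exact M.ordConnected_range.isPreconnected.intermediate_value hμ hν hM.g_continuous ⟨h1, h2⟩

lemma linkInv_mem (hM : M.Standing) (c : ℝ) : M.linkInv c ∈ M.range :=
  Function.invFunOn_mem (hM.mem_image_g c)

lemma g_linkInv (hM : M.Standing) (c : ℝ) : M.g (M.linkInv c) = c :=
  Function.invFunOn_eq (hM.mem_image_g c)

lemma strictMono_linkInv (hM : M.Standing) : StrictMono M.linkInv := fun c d hcd =>
  (hM.g_strictMono.lt_iff_lt (hM.linkInv_mem c) (hM.linkInv_mem d)).1 (by
    rwa [hM.g_linkInv, hM.g_linkInv])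

lemma measurable_m_linkInv (hM : M.Standing) (hA2 : M.A2) :
    Measurable fun c => M.m (M.linkInv c) := by
  refine Monotone.measurable fun c d hcd => ?_
  exact hA2.strictMono.monotoneOn (hM.linkInv_mem c) (hM.linkInv_mem d)
    (hM.strictMono_linkInv.monotone hcd)

variable {p : ℕ}

lemma measurable_loss (hM : M.Standing) (hA2 : M.A2) (β : Vec p) :
    Measurable fun z : ℝ × Vec p => M.loss z β := by
  have h1 := hM.isRhoFunction.continuous.measurable
  have h2 := hM.t_measurable
  have h3 : Measurable fun z : ℝ × Vec p => M.m (M.linkInv (inner ℝ z.2 β)) :=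
    (hM.measurable_m_linkInv hA2).comp (by fun_prop)
  unfold loss
  exact h1.comp (((h2.comp measurable_fst).sub h3).div_const _)

lemma loss_nonneg (hM : M.Standing) (z : ℝ × Vec p) (β : Vec p) : 0 ≤ M.loss z β :=
  hM.isRhoFunction.nonneg _

lemma loss_le_one (hM : M.Standing) (z : ℝ × Vec p) (β : Vec p) : M.loss z β ≤ 1 :=
  hM.isRhoFunction.le_one _

lemma isLocMin_m (hA2 : M.A2) {μ : ℝ} (hμ : μ ∈ M.range) : M.IsLocMin μ (M.m μ) :=
  Classical.epsilon_spec (hA2.existsUnique μ hμ).exists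

/-- Fisher consistency: the true parameter minimizes the expected loss, because `m μ` minimizes the
conditional expected loss given the covariates. -/
lemma integral_loss_le (hM : M.Standing) (hA2 : M.A2) {βs : Vec p} {Q : Measure (ℝ × Vec p)}
    [IsProbabilityMeasure Q] (hQ : M.IsGLM βs Q) (β : Vec p) :
    ∫ z, M.loss z βs ∂Q ≤ ∫ z, M.loss z β ∂Q := by
  have hint (γ : Vec p) : Integrable (fun z => M.loss z γ) Q :=
    Integrable.of_bound (hM.measurable_loss hA2 γ).aestronglyMeasurable 1
      (Eventually.of_forall fun z => by
        rw [Real.norm_of_nonneg (hM.loss_nonneg z γ)]; exact hM.loss_le_one z γ)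
  have hcond (γ : Vec p) : Q[fun z => M.loss z γ | MeasurableSpace.comap Prod.snd inferInstance]
      =ᵐ[Q] fun z => M.locLoss (M.linkInv (inner ℝ z.2 βs)) (M.m (M.linkInv (inner ℝ z.2 γ))) := by
    have h1 := condExp_prod_ae_eq_integral_condDistrib (μ := Q) (X := Prod.snd) (Y := Prod.fst)
      (f := fun v : Vec p × ℝ => M.loss (v.2, v.1) γ) measurable_snd
      measurable_fst.aemeasurable
      ((hM.measurable_loss hA2 γ).comp measurable_swap).stronglyMeasurable (hint γ)
    filter_upwards [h1, hQ.cond] with z hz1 hz2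
    rw [hz2] at hz1
    exact hz1
  have hle : MeasurableSpace.comap (Prod.snd : ℝ × Vec p → Vec p) inferInstance
      ≤ (inferInstance : MeasurableSpace (ℝ × Vec p)) := measurable_snd.comap_le
  rw [← integral_condExp hle (f := fun z => M.loss z βs),
    ← integral_condExp hle (f := fun z => M.loss z β)]
  refine integral_mono_ae integrable_condExp integrable_condExp ?_
  filter_upwards [hcond βs, hcond β] with z h1 h2
  rw [h1, h2]
  exact isLocMin_m hA2 (hM.linkInv_mem _) _

lemma exists_regularLoss (hM : M.Standing) (hA2 : M.A2) {βs : Vec p} {Q : Measure (ℝ × Vec p)}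
    (hC4 : M.C4 Q βs) : ∃ η S, RegularLoss Q M.loss βs η S := by
  obtain ⟨⟨η, hη, hdiff, hJ⟩, -⟩ := hC4
  refine ⟨η, fun z => ∑ j, ∑ k, (⨆ β ∈ Metric.closedBall βs η, ‖M.J z β j k‖ₑ).toReal, hη,
    hM.measurable_loss hA2, hM.loss_nonneg, hM.loss_le_one, ?_, ?_, ?_, ?_⟩
  · exact integrable_finsetSum _ fun j _ => integrable_finsetSum _ fun k _ =>
      integrable_toReal_of_lintegral_ne_top (hJ j k).1 (hJ j k).2.ne
  · filter_upwards [hdiff] with z hz β hβ using (hz β hβ).1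
  · filter_upwards [hdiff] with z hz β hβ using (hz β hβ).2
  · have hfin : ∀ᵐ z ∂Q, ∀ j k, ⨆ β ∈ Metric.closedBall βs η, ‖M.J z β j k‖ₑ < ∞ :=
      ae_all_iff.2 fun j => ae_all_iff.2 fun k => ae_lt_top' (hJ j k).1 (hJ j k).2.ne
    filter_upwards [hfin] with z hz β hβ
    refine (norm_le_sum_abs_opMatrix _).trans
      (Finset.sum_le_sum fun j _ => Finset.sum_le_sum fun k _ => ?_)
    rw [← Real.norm_eq_abs, ← toReal_enorm]
    exact ENNReal.toReal_mono (hz j k).ne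
      (le_iSup₂ (f := fun β (_ : β ∈ Metric.closedBall βs η) => ‖M.J z β j k‖ₑ) β hβ)

end Standing

end Model

end PenalizedMT

open PenalizedMT in
theorem theorem5 {p : ℕ} {Ω : Type*} [MeasurableSpace Ω] (P : Measure Ω) [IsProbabilityMeasure P]
    (M : Model) (hM : M.Standing)
    -- the true parameter and the law of `(y, x)`
    (βs : Vec p) (hβs : βs ≠ 0)
    (Q : Measure (ℝ × Vec p)) [IsProbabilityMeasure Q] (hQ : M.IsGLM βs Q)
    -- the i.i.d. sample `z i = (yᵢ, xᵢ)`
    (z : ℕ → Ω → ℝ × Vec p) (hz_meas : ∀ i, Measurable (z i))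
    (hz_law : ∀ i, HasLaw (z i) Q P) (hz_indep : iIndepFun z P)
    -- the penalty; all slopes are penalized, and the intercept may be penalized or not
    (T : Finset (Fin (p + 1))) (hT : ∀ j, j ≠ 0 → j ∈ T)
    (pen : Penalty) (hpen : pen.Admissible)
    -- the (possibly random) penalty parameters and the estimator
    (lam : ℕ → Ω → ℝ) (hlam_meas : ∀ n, Measurable (lam n))
    (βhat : ℕ → Ω → Vec p) (hβhat_meas : ∀ n, Measurable (βhat n))
    (hβhat : ∀ n, 1 ≤ n → ∀ᵐ ω ∂P, ∀ β,
      objective M T pen n (fun i => z i ω) (lam n ω) (βhat n ω)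
        ≤ objective M T pen n (fun i => z i ω) (lam n ω) β)
    -- assumptions
    (hA2 : M.A2) (hC1 : M.C1) (hC2 : M.C2) (hC3 : M.C3) (hC4 : M.C4 Q βs)
    (hP1 : pen.P1 T βs)
    (hrate : BoundedInProb P (fun (n : ℕ) ω => √(n : ℝ) • (βhat n ω - βs)))
    (b : ℝ) (hb : 0 ≤ b)
    (hlam : TendstoInMeasure P (fun (n : ℕ) ω => √(n : ℝ) * lam n ω) atTop (fun _ => b)) :
    -- the matrix `B` is well defined
    (∀ j k, Integrable (fun z => M.Psi z βs j * M.Psi z βs k) Q) ∧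
    -- `R` has a unique minimizer `W w₀`, and it is the limit in distribution for `w₀ ∼ N(0, B)`
    ∃ W : Vec p → Vec p, Measurable W ∧
      (∀ w₀ w, w ≠ W w₀ →
        R (M.A Q βs) b (pen.q T βs) w₀ (W w₀) < R (M.A Q βs) b (pen.q T βs) w₀ w) ∧
      TendstoInDistribution (fun (n : ℕ) ω => √(n : ℝ) • (βhat n ω - βs)) atTop W
        (fun _ => P) (multivariateGaussian 0 (M.B Q βs)) := by
  obtain ⟨η, S, hreg⟩ := hM.exists_regularLoss hA2 hC4
  have hmin := hM.integral_loss_le hA2 hQ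
  obtain ⟨κ, hκ0, hκ⟩ := hreg.exists_le_meanHessian hmin hC4.2
  have hq := pen.isPenaltyTangent hpen hP1
  obtain ⟨C, -, hC⟩ := hq.exists_bound
  refine ⟨hreg.integrable_gradient_mul, ?_⟩
  choose W hW using exists_minimizer_R (b := b) hκ0 hκ hq.continuous hC
  have hWcont : Continuous W :=
    (LipschitzWith.of_dist_le_mul (K := (2 / κ).toNNReal) fun u v => by
      rw [dist_eq_norm, dist_eq_norm, Real.coe_toNNReal _ (by positivity)]
      exact norm_minimizer_sub_le hκ0 hκ hb hq.convexOn hW u v).continuous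
  refine ⟨W, hWcont.measurable, fun w₀ w hw => ?_, ?_⟩
  · have h1 := add_le_of_strongConvexOn (strongConvexOn_R hκ hb hq.convexOn w₀) (hW w₀) w
    have h2 : 0 < ‖w - W w₀‖ := norm_pos_iff.2 (sub_ne_zero.2 hw)
    have h3 : 0 < κ / 4 * ‖w - W w₀‖ ^ 2 := by positivity
    exact lt_of_lt_of_le (lt_add_of_pos_right _ h3) h1
  · have hscore := (tendstoInDistribution_score hreg hmin hz_law hz_indep).continuous_comp hWcont
    refine tendstoInDistribution_of_tendstoInMeasure_sub _ _ hscore ?_ fun n =>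
      (((hβhat_meas n).sub_const βs).const_smul (√(n : ℝ))).aemeasurable
    refine tendstoInMeasure_sub_minimizer hreg hz_law hz_indep hκ0 hκ hq
      (fun n hn => ?_) hrate hb hlam hW
    filter_upwards [hβhat n hn] with ω hω β
    have := hω β
    rwa [objective, objective, Penalty.eval_eq_mul, Penalty.eval_eq_mul _ _ _ β] at this
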